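/- **Setting.** Let $(\Omega,\mathcal F)$ be a measurable space and $\mathscr H$ a linear space of real measurable functions on $\Omega$ such that $\psi(Y_1,\dots,Y_n)\in\mathscr H$ whenever $Y_1,\dots,Y_n\in\mathscr H$ and $\psi:\mathbb R^n\to\mathbb R$ satisfies $|\psi(x)-\psi(y)|\le C(1+|x|^m+|y|^m)|x-y|$ for some $C>0$, $m\in\mathbb N$. Let $\hat{\mathbb E}:\mathscr H\to[-\infty,\infty]$ be a sub-linear expectation, i.e. monotone, with $\hat{\mathbb E}[c]=c$ for constants $c$, $\hat{\mathbb E}[X+Y]\le\hat{\mathbb E}[X]+\hat{\mathbb E}[Y]$ whenever the right side is not of the form $\infty-\infty$, and $\hat{\mathbb E}[\lambda X]=\lambda\hat{\mathbb E}[X]$ for $\lambda\ge0$. Let $\mathscr H_b$ be the set of bounded elements of $\mathscr H$. Define $$\widehat{\mathbb V}(A)=\inf\{\hat{\mathbb E}[\xi]:I_A\le\xi,\ \xi\in\mathscr H\},\qquad \widehat{\mathbb V}^*(A)=\inf\Big\{\sum_{n\ge1}\widehat{\mathbb V}(A_n):A\subset\bigcup_{n\ge1} A_n,\ A_n\in\mathcal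 F\Big\},\qquad A\in\mathcal F.$$ Let $X_1,X_2,\ldots\in\mathscr H$ be i.i.d. under $\hat{\mathbb E}$: for all $i\ge1$, $\hat{\mathbb E}[\psi(X_i)]=\hat{\mathbb E}[\psi(X_1)]$ for every bounded Lipschitz $\psi$ on $\mathbb R$, and $\hat{\mathbb E}[\psi(X_1,\dots,X_{i+1})]=\hat{\mathbb E}\big[\hat{\mathbb E}[\psi(x_1,\dots,x_i,X_{i+1})]\big|_{x_1=X_1,\dots,x_i=X_i}\big]$ for every bounded Lipschitz $\psi$ on $\mathbb R^{i+1}$. Assume that the Choquet expectation of $|X_1|$ is finite, $\int_0^\infty\widehat{\mathbb V}(|X_1|\ge t)\,dt<\infty$. Put $\bm X=(X_1,X_2,\ldots)$ and $S_n=\sum_{i=1}^nX_i$. Let $\mathscr P$ be a family of probability measures on $\sigma(\mathscr H)$ such that $\hat{\mathbb E}[Y]=\sup_{P\in\mathscr P}E_P[Y]$ for all $Y\in\mathscr H_b$ and such that, for all $Y_1,Y_2,\ldots\in\mathscr H_b$, the set $\{P\circ(Y_1,Y_2,\ldots)^{-1}:P\in\mathscr P\}$ of laws is weakly compact in the space of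 probability measures on $\mathbb R^{\mathbb N}$ (with the product topology). Let $\mathbb L_c$ be the completion of $C_b(\mathbb R^{\mathbb N})$ under $\sup_{P\in\mathscr P}E_P[|\,\cdot\,(\bm X)|]$, that is, the set of Borel functions $\varphi:\mathbb R^{\mathbb N}\to\mathbb R$ such that for every $\varepsilon>0$ there is $f\in C_b(\mathbb R^{\mathbb N})$ with $\sup_{P\in\mathscr P}E_P[|\varphi(\bm X)-f(\bm X)|]\le\varepsilon$. **Statement.** The limits $\overline\mu=\lim_{c\to\infty}\hat{\mathbb E}[(-c)\vee X_1\wedge c]$ and $\underline\mu=-\lim_{c\to\infty}\hat{\mathbb E}[(-c)\vee(-X_1)\wedge c]$ exist and are finite, and the following holds. (a) For every $d$ and every Borel measurable $\varphi:\mathbb R^d\to\mathbb R$ there is a probability measure $Q$ on $(\Omega,\sigma(\mathscr H))$ such that $E_Q[Y]\le\hat{\mathbb E}[Y]$ for all $Y\in\mathscr H_b$ and $$\widehat{\mathbb V}^*\Big(\lim_{n\to\infty}\frac{S_n}{n}=\underline\mu\vee\varphi(X_1,\ldots,X_d)\wedge\overline\mu\Big)=Q\Big(\lim_{n\to\infty}\frac{S_n}{n}=\underline\mu\vee\varphi(X_1,\ldots,X_d)\wedge\overline\mu\Big)=1.$$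 (b) For every continuous $\varphi:\mathbb R^{\mathbb N}\to\mathbb R$ there is $P\in\mathscr P$ such that $$\widehat{\mathbb V}^*\Big(\lim_{n\to\infty}\frac{S_n}{n}=\underline\mu\vee\varphi(\bm X)\wedge\overline\mu\Big)=P\Big(\lim_{n\to\infty}\frac{S_n}{n}=\underline\mu\vee\varphi(\bm X)\wedge\overline\mu\Big)=1.$$ The conclusion of (b) also holds for every $\varphi\in\mathbb L_c$. -/

import Mathlib

open Filter Topology MeasureTheory
open scoped ENNReal BoundedContinuousFunction

noncomputable section

namespace SubLin

/-- The class `C_{l,Lip}(ℝⁿ)` of local Lipschitz functions with polynomial growth. (The sup norm of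
`Fin n → ℝ` is equivalent to the Euclidean norm, hence yields the same class of functions.) -/
def LocLip {n : ℕ} (φ : (Fin n → ℝ) → ℝ) : Prop :=
  ∃ C : ℝ, ∃ m : ℕ, 0 < C ∧
    ∀ x y : Fin n → ℝ, |φ x - φ y| ≤ C * (1 + ‖x‖ ^ m + ‖y‖ ^ m) * ‖x - y‖

/-- Bounded Lipschitz functions, `C_{b,Lip}`. -/
def BddLip {E : Type*} [PseudoEMetricSpace E] (φ : E → ℝ) : Prop :=
  (∃ K, LipschitzWith K φ) ∧ ∃ M : ℝ, ∀ x, |φ x| ≤ M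

/-- The datum `(ℋ, 𝔼)` of a sub-linear expectation space over the measurable space `Ω`. The
expectation is written as a total function; its values outside `ℋ` are irrelevant. -/
structure SubLinSpace (Ω : Type*) [MeasurableSpace Ω] where
  /-- the linear space `ℋ` of random variables -/
  H : Submodule ℝ (Ω → ℝ)
  measurable_of_mem : ∀ X ∈ H, Measurable X
  comp_mem : ∀ (n : ℕ) (X : Fin n → Ω → ℝ), (∀ i, X i ∈ H) →
    ∀ φ : (Fin n → ℝ) → ℝ, LocLip φ → (fun ω => φ (fun i => X i ω)) ∈ H
  /-- the sub-linear expectation -/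
  E : (Ω → ℝ) → EReal
  mono : ∀ X ∈ H, ∀ Y ∈ H, (∀ ω, Y ω ≤ X ω) → E Y ≤ E X
  const : ∀ c : ℝ, E (fun _ => c) = (c : EReal)
  subadd : ∀ X ∈ H, ∀ Y ∈ H, ¬ (E X = ⊤ ∧ E Y = ⊥) → ¬ (E X = ⊥ ∧ E Y = ⊤) →
    E (fun ω => X ω + Y ω) ≤ E X + E Y
  homog : ∀ X ∈ H, ∀ r : ℝ, 0 ≤ r → E (fun ω => r * X ω) = (r : EReal) * E X

namespace SubLinSpace

variable {Ω : Type*} [MeasurableSpace Ω] (S : SubLinSpace Ω)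

/-- The bounded elements `ℋ_b` of `ℋ`. -/
def Hb : Set (Ω → ℝ) := {X | X ∈ S.H ∧ ∃ M : ℝ, ∀ ω, |X ω| ≤ M}

/-- The `σ`-algebra `σ(ℋ)`. -/
@[reducible] def sigma : MeasurableSpace Ω :=
  ⨆ X ∈ S.H, MeasurableSpace.comap X (borel ℝ)

/-- Probability measures on `(Ω, σ(ℋ))`. -/
abbrev Prob : Type _ := @ProbabilityMeasure Ω S.sigma

/-- Two random vectors (possibly on different spaces) are identically distributed. -/
def IdentDist {Ω' : Type*} [MeasurableSpace Ω'] (S' : SubLinSpace Ω') {n : ℕ}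
    (X : Fin n → Ω → ℝ) (Y : Fin n → Ω' → ℝ) : Prop :=
  ∀ φ : (Fin n → ℝ) → ℝ, BddLip φ →
    S.E (fun ω => φ (fun i => X i ω)) = S'.E (fun ω => φ (fun i => Y i ω))

/-- The random vector `Y` is independent to the random vector `X`. For bounded `φ` the inner
expectation is a finite number. -/
def IndepTo {m n : ℕ} (Y : Fin n → Ω → ℝ) (X : Fin m → Ω → ℝ) : Prop :=
  ∀ φ : (Fin m → ℝ) × (Fin n → ℝ) → ℝ, BddLip φ →
    S.E (fun ω => φ (fun i => X i ω, fun j => Y j ω)) =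
      S.E (fun ω => (S.E (fun ω' => φ (fun i => X i ω, fun j => Y j ω'))).toReal)

/-- An independent and identically distributed sequence in `ℋ`; the variables `X₁, X₂, …` are
`X 0, X 1, …`. -/
structure IsIID (X : ℕ → Ω → ℝ) : Prop where
  mem : ∀ i, X i ∈ S.H
  ident : ∀ i, S.IdentDist S (fun _ : Fin 1 => X i) (fun _ : Fin 1 => X 0)
  indep : ∀ i : ℕ, S.IndepTo (fun _ : Fin 1 => X (i + 1)) (fun j : Fin (i + 1) => X j)

/-- The upper capacity `𝕍(A) = inf {𝔼[ξ] : I_A ≤ ξ, ξ ∈ ℋ}` (the numbers `𝔼[ξ]` are all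
nonnegative). -/
def upCap (A : Set Ω) : ℝ≥0∞ :=
  ⨅ (ξ : Ω → ℝ) (_ : ξ ∈ S.H) (_ : ∀ ω, A.indicator (fun _ => (1 : ℝ)) ω ≤ ξ ω),
    (S.E ξ).toENNReal

/-- The countably sub-additive extension `𝕍^*` of the upper capacity; the covers consist of
events of the underlying measurable space. -/
def outCap (A : Set Ω) : ℝ≥0∞ :=
  ⨅ (B : ℕ → Set Ω) (_ : ∀ n, MeasurableSet (B n)) (_ : A ⊆ ⋃ n, B n), ∑' n, S.upCap (B n)

/-- The truncation `X^{(c)} = (-c) ∨ X ∧ c`. -/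
def trunc (c : ℝ) (X : Ω → ℝ) : Ω → ℝ := fun ω => max (-c) (min (X ω) c)

/-- `m` is the limit of `𝔼[X^{(c)}]` as `c → ∞`. -/
def IsTruncMean (X : Ω → ℝ) (m : ℝ) : Prop :=
  Tendsto (fun c : ℝ => S.E (trunc c X)) atTop (𝓝 (m : EReal))

/-- The condition (CC): `𝔼` is represented on `ℋ_b` by the family `Pfam`, and `Pfam` is
countable-dimensionally weakly compact. The product topology of `ℕ → ℝ` is the one of the metric
`∑ (|xᵢ - yᵢ| ∧ 1) / 2ⁱ`, and `ProbabilityMeasure` carries the topology of weak convergence. -/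
structure CC (Pfam : Set S.Prob) : Prop where
  repr : ∀ X ∈ S.Hb, S.E X = ⨆ P ∈ Pfam, ((∫ ω, X ω ∂P.1 : ℝ) : EReal)
  compact : ∀ Y : ℕ → Ω → ℝ, (∀ n, Y n ∈ S.Hb) →
    IsCompact {ν : ProbabilityMeasure (ℕ → ℝ) |
      ∃ P ∈ Pfam, ∀ A : Set (ℕ → ℝ), MeasurableSet A →
        ν.1 A = P.1 {ω | (fun n => Y n ω) ∈ A}}

/-- The space `𝕃_c`: the Borel functions `φ` on `ℝ^ℕ` that are limits of bounded continuous
functions `f` in the norm `sup_{P ∈ Pfam} E_P[|φ(X) - f(X)|]`. -/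
def MemLc (Pfam : Set S.Prob) (X : ℕ → Ω → ℝ) (φ : (ℕ → ℝ) → ℝ) : Prop :=
  Measurable φ ∧ ∀ ε : ℝ≥0∞, 0 < ε → ∃ f : (ℕ → ℝ) →ᵇ ℝ,
    (⨆ P ∈ Pfam, ∫⁻ ω, ENNReal.ofReal |φ (fun n => X n ω) - f (fun n => X n ω)| ∂P.1) ≤ ε

end SubLinSpace

/-- The Choquet integral
`∫_0^∞ V(X ≥ t) dt + ∫_{-∞}^0 (V(X ≥ t) - 1) dt` for a capacity `V` with values in `[0, 1]`. -/
def choquet {Ω : Type*} (V : Set Ω → ℝ≥0∞) (X : Ω → ℝ) : EReal :=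
  ((∫⁻ t in Set.Ioi (0 : ℝ), V {ω | t ≤ X ω} : ℝ≥0∞) : EReal) -
    ((∫⁻ t in Set.Iio (0 : ℝ), (1 - V {ω | t ≤ X ω}) : ℝ≥0∞) : EReal)

/-- The event `lim S_n / n = μlo ∨ Z ∧ μhi`, where `S_n = X₁ + ⋯ + X_n`. -/
def limEvent {Ω : Type*} (X : ℕ → Ω → ℝ) (μlo μhi : ℝ) (Z : Ω → ℝ) : Set Ω :=
  {ω | Tendsto (fun n : ℕ => (∑ i ∈ Finset.range n, X i ω) / (n : ℝ)) atTop
    (𝓝 (max μlo (min (Z ω) μhi)))}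

end SubLin

end

open Filter Topology MeasureTheory
open scoped ENNReal BoundedContinuousFunction

noncomputable section

namespace SubLin

/-! ### Bounded Lipschitz functions -/

/-! The laws of `X` under the measures of `Pfam` form a family `𝒬` on sequences whose upper
expectation makes the coordinates i.i.d. The theorem is a stochastic control statement for `𝒬`: the
drift of the next increment may be chosen anywhere between the lower and the upper mean depending on
the past, so the running average can be steered to any target in that interval revealed along the
way.

Let `σ n` be a bounded Lipschitz function of the first `n` coordinates and `T n` the `n`-th
coordinate clipped at level `n`. The largest upper expectation of `s * T n` is `gain 𝒬 n s`, so
`deficit` has nonnegative mean under every law. By independence, subtracting any multiple of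
finitely many deficits from time `d` on leaves the upper expectation of a function of the first `d`
coordinates unchanged (`upE_sub_deficit`). Letting the multiple grow, compactness of the moments
produces one law under which all these deficits have mean zero (`exists_optimal`). There the
conditional mean of `T n` given the past equals the upper mean where `σ n > 0` and the lower mean
where `σ n < 0`. Taking for `σ n` the clipped difference between a target `τ n` and the current
average gives a feedback rule. Borel–Cantelli and the martingale strong law make the noise
negligible (`ae_exists_drift`), and a deterministic argument shows that the averages follow `τ n` to
its limit (`tendsto_average_of_control`).

It remains to approximate `φ` by Lipschitz targets. For `𝕃_c` this works simultaneously almost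
surely under all laws of the family (`exists_target`), so any optimal law will do; a continuous `φ`
may be clamped and then lies in `𝕃_c`. For a Borel function of `d` coordinates the approximation
works only under a fixed law of these coordinates, while the optimal law depends on the
approximation. The circularity is broken by fixing beforehand a law whose moments for a determining
sequence are lexicographically maximal: such moments can be retained while the deficits are made to
vanish (`exists_extension`). No convexity of the family is needed. -/

/-- Truncation of a real number to `[-c, c]`. -/
def clip (c x : ℝ) : ℝ := max (-c) (min x c)

theorem abs_clip_le {c : ℝ} (hc : 0 ≤ c) (x : ℝ) : |clip c x| ≤ c :=
  abs_le.2 ⟨le_max_left _ _, max_le (by linarith) (min_le_right _ _)⟩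

theorem clip_eq_self {c x : ℝ} (h : |x| ≤ c) : clip c x = x := by
  rw [abs_le] at h
  rw [clip, min_eq_left h.2, max_eq_right h.1]

theorem lipschitzWith_clip (c : ℝ) : LipschitzWith 1 (clip c) :=
  (LipschitzWith.id.min_const c).const_max (-c)

theorem lipschitzWith_clamp (a b : ℝ) : LipschitzWith 1 (fun x : ℝ => max a (min x b)) :=
  (LipschitzWith.id.min_const b).const_max a

theorem continuous_clip (c : ℝ) : Continuous (clip c) := (lipschitzWith_clip c).continuous

theorem clip_neg {c : ℝ} (hc : 0 ≤ c) (x : ℝ) : clip c (-x) = -clip c x := by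
  unfold clip
  rcases le_total x (-c) with h | h <;> rcases le_total x c with h' | h' <;>
    simp only [max_def, min_def] <;> split_ifs <;> linarith

namespace BddLip

section Metric

variable {E F : Type*} [PseudoMetricSpace E] [PseudoMetricSpace F] {f g : E → ℝ}

theorem of_dist_le {K M : ℝ} (h : ∀ x y, |f x - f y| ≤ K * dist x y) (hM : ∀ x, |f x| ≤ M) :
    BddLip f := by
  refine ⟨⟨K.toNNReal, LipschitzWith.of_dist_le_mul fun x y => ?_⟩, M, hM⟩
  rw [Real.dist_eq]
  exact (h x y).trans (mul_le_mul_of_nonneg_right (Real.le_coe_toNNReal K) dist_nonneg)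

theorem exists_bounds (h : BddLip f) :
    ∃ K M : ℝ, 0 ≤ K ∧ 0 ≤ M ∧ (∀ x y, |f x - f y| ≤ K * dist x y) ∧ ∀ x, |f x| ≤ M := by
  obtain ⟨⟨K, hK⟩, M, hM⟩ := h
  refine ⟨K, max M 0, K.2, le_max_right _ _, fun x y => ?_, fun x => (hM x).trans (le_max_left _ _)⟩
  rw [← Real.dist_eq]
  exact hK.dist_le_mul x y

theorem continuous (h : BddLip f) : Continuous f := h.1.choose_spec.continuous

theorem const (c : ℝ) : BddLip (fun _ : E => c) :=
  ⟨⟨0, LipschitzWith.const c⟩, |c|, fun _ => le_rfl⟩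

theorem add (hf : BddLip f) (hg : BddLip g) : BddLip (fun x => f x + g x) := by
  obtain ⟨⟨K, hK⟩, M, hM⟩ := hf
  obtain ⟨⟨K', hK'⟩, M', hM'⟩ := hg
  exact ⟨⟨_, hK.add hK'⟩, M + M', fun x => (abs_add_le _ _).trans (add_le_add (hM x) (hM' x))⟩

theorem neg (hf : BddLip f) : BddLip (fun x => -f x) := by
  obtain ⟨⟨K, hK⟩, M, hM⟩ := hf
  exact ⟨⟨_, hK.neg⟩, M, fun x => by rw [abs_neg]; exact hM x⟩

theorem sub (hf : BddLip f) (hg : BddLip g) : BddLip (fun x => f x - g x) := by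
  simpa only [sub_eq_add_neg] using hf.add hg.neg

theorem mul (hf : BddLip f) (hg : BddLip g) : BddLip (fun x => f x * g x) := by
  obtain ⟨K, M, hK, hM, h1, h2⟩ := hf.exists_bounds
  obtain ⟨K', M', hK', hM', h1', h2'⟩ := hg.exists_bounds
  refine of_dist_le (K := M * K' + M' * K) (M := M * M') (fun x y => ?_) fun x => ?_
  · have : f x * g x - f y * g y = f x * (g x - g y) + g y * (f x - f y) := by ring
    rw [this]
    refine (abs_add_le _ _).trans ?_
    rw [abs_mul, abs_mul, add_mul, mul_assoc, mul_assoc]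
    gcongr
    exacts [h2 x, h1' x y, h2' y, h1 x y]
  · rw [abs_mul]
    exact mul_le_mul (h2 x) (h2' x) (abs_nonneg _) hM

theorem const_mul (c : ℝ) (hf : BddLip f) : BddLip (fun x => c * f x) := (const c).mul hf

theorem comp {u : F → E} {K : NNReal} (hf : BddLip f) (hu : LipschitzWith K u) :
    BddLip (fun x => f (u x)) := by
  obtain ⟨⟨L, hL⟩, M, hM⟩ := hf
  exact ⟨⟨_, hL.comp hu⟩, M, fun x => hM _⟩

theorem comp_left {u : ℝ → ℝ} {K : NNReal} (hu : LipschitzWith K u) (hf : BddLip f) :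
    BddLip (fun x => u (f x)) := by
  obtain ⟨⟨L, hL⟩, M, hM⟩ := hf
  refine ⟨⟨_, hu.comp hL⟩, |u 0| + K * M, fun x => ?_⟩
  have h1 := hu.dist_le_mul (f x) 0
  rw [Real.dist_eq, Real.dist_eq, sub_zero] at h1
  have h2 : (K : ℝ) * |f x| ≤ K * M := mul_le_mul_of_nonneg_left (hM x) K.2
  have h3 := abs_add_le (u 0) (u (f x) - u 0)
  rw [add_sub_cancel] at h3
  linarith

/-- A Lipschitz function becomes bounded Lipschitz after clamping. -/
theorem clamp {K : NNReal} (a b : ℝ) (hf : LipschitzWith K f) :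
    BddLip (fun x => max a (min (f x) b)) := by
  refine ⟨⟨_, (lipschitzWith_clamp a b).comp hf⟩, |a| + |b|, fun x => ?_⟩
  rw [abs_le]
  constructor
  · have := le_max_left a (min (f x) b)
    linarith [neg_abs_le a, abs_nonneg b]
  · refine max_le ?_ ((min_le_right _ _).trans ?_) <;>
      linarith [le_abs_self a, le_abs_self b, abs_nonneg a, abs_nonneg b]

theorem clip {K : NNReal} (c : ℝ) (hf : LipschitzWith K f) :
    BddLip (fun x => clip c (f x)) := clamp (-c) c hf

end Metric

end BddLip

/-! ### Deterministic limit lemmas -/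

/-- Kronecker's lemma with weights `i + 1`. -/
theorem kronecker {ξ : ℕ → ℝ} {s : ℝ}
    (h : Tendsto (fun n => ∑ i ∈ Finset.range n, ξ i / (i + 1)) atTop (𝓝 s)) :
    Tendsto (fun n : ℕ => (∑ i ∈ Finset.range n, ξ i) / n) atTop (𝓝 0) := by
  set u : ℕ → ℝ := fun n => ∑ i ∈ Finset.range n, ξ i / (i + 1) with hu
  -- Summation by parts; after division by `n` the right side is a convergent sequence minus its
  -- Cesàro means.
  have key : ∀ n : ℕ, ∑ i ∈ Finset.range n, ξ i = n * u n - ∑ i ∈ Finset.range n, u i := by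
    intro n
    induction n with
    | zero => simp
    | succ n ih =>
      rw [Finset.sum_range_succ, Finset.sum_range_succ, ih]
      have : u (n + 1) = u n + ξ n / (n + 1) := by simp only [hu, Finset.sum_range_succ]
      rw [this]
      have hn : (n : ℝ) + 1 ≠ 0 := by positivity
      push_cast
      field_simp
      ring
  have := h.sub h.cesaro
  rw [sub_self] at this
  refine this.congr' ?_
  filter_upwards [eventually_gt_atTop 0] with n hn
  have hn' : (n : ℝ) ≠ 0 := by positivity
  rw [key]
  field_simp

/-- One-sided control lemma: if the drift is at most `t + o(1)` whenever the average exceeds the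
running target, then the average cannot stay above the limit of the target. -/
theorem eventually_average_le {x m lo τ : ℕ → ℝ} {d : ℕ} {L t B : ℝ}
    (hnoise : Tendsto (fun n : ℕ => (∑ i ∈ Finset.range n, (x i - m i)) / n) atTop (𝓝 0))
    (hlo : Tendsto lo atTop (𝓝 L)) (hLt : L ≤ t) (hτ : Tendsto τ atTop (𝓝 t))
    (hB : ∀ n, d ≤ n → m n ≤ B)
    (hctl : ∀ n, d ≤ n → τ n < (∑ i ∈ Finset.range n, x i) / n → m n = lo n)
    {ε : ℝ} (hε : 0 < ε) :
    ∀ᶠ n : ℕ in atTop, (∑ i ∈ Finset.range n, x i) / n ≤ t + ε := by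
  -- Of the five shares of `ε`, three pay for the growth of `U`, one for the constant `C`, one for
  -- the noise.
  set δ := ε / 5 with hδ
  have hδ0 : 0 < δ := by positivity
  have e1 : ∀ᶠ n : ℕ in atTop, |(∑ i ∈ Finset.range n, (x i - m i)) / n| < δ := by
    simpa only [Real.dist_eq, sub_zero] using Metric.tendsto_nhds.1 hnoise δ hδ0
  have e2 : ∀ᶠ n in atTop, lo n < t + δ := hlo.eventually_lt_const (by linarith)
  have e3 : ∀ᶠ n in atTop, τ n < t + δ := hτ.eventually_lt_const (by linarith)
  obtain ⟨N, hN⟩ := eventually_atTop.1 (e1.and (e2.and (e3.and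
    ((eventually_ge_atTop d).and (eventually_gt_atTop 0)))))
  set U : ℕ → ℝ := fun n => ∑ i ∈ Finset.range n, (m i - t) with hU
  have hS : ∀ n, ∑ i ∈ Finset.range n, x i
      = U n + n * t + ∑ i ∈ Finset.range n, (x i - m i) := by
    intro n
    simp only [hU, Finset.sum_sub_distrib, Finset.sum_const, Finset.card_range, nsmul_eq_mul]
    ring
  have hno : ∀ n, N ≤ n → |∑ i ∈ Finset.range n, (x i - m i)| ≤ δ * n := by
    intro n hn
    have h0 : (0 : ℝ) < n := by exact_mod_cast (hN n hn).2.2.2.2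
    have h := (hN n hn).1
    rw [abs_div, abs_of_pos h0, div_lt_iff₀ h0] at h
    exact h.le
  set C := max (U N) 0 + |B - t| with hC
  have hC0 : 0 ≤ C := by positivity
  -- If `U n ≤ 2 * δ * n`, one step adds at most `|B - t|`, which `C` absorbs. Otherwise the average
  -- exceeds `τ n` despite the noise, so the drift is `lo n < t + δ` and `U` grows by less than `δ`.
  have key : ∀ n, N ≤ n → U n ≤ C + 3 * δ * n := by
    intro n hn
    induction n, hn using Nat.le_induction with
    | base =>
      have : 0 ≤ 3 * δ * (N : ℝ) := by positivity
      linarith [le_max_left (U N) 0, abs_nonneg (B - t)]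
    | succ n hn ih =>
      obtain ⟨-, h2, h3, h4, h5⟩ := hN n hn
      have h0 : (0 : ℝ) < n := by exact_mod_cast h5
      have hsucc : U (n + 1) = U n + (m n - t) := by simp only [hU, Finset.sum_range_succ]
      have habs := abs_le.1 (hno n hn)
      have hδn : 0 ≤ δ * (n : ℝ) := by positivity
      push_cast
      rcases le_or_gt (U n) (2 * δ * n) with hle | hgt
      · have := hB n h4
        have := le_abs_self (B - t)
        have := le_max_right (U N) 0
        nlinarith
      · have : τ n < (∑ i ∈ Finset.range n, x i) / n := by
          rw [lt_div_iff₀ h0, hS]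
          nlinarith [habs.1]
        rw [hsucc, hctl n h4 this]
        nlinarith
  obtain ⟨N', hN'⟩ := exists_nat_gt (C / δ)
  filter_upwards [eventually_ge_atTop N, eventually_ge_atTop N'] with n h1 h2
  have h0 : (0 : ℝ) < n := by exact_mod_cast (hN n h1).2.2.2.2
  have h3 : C ≤ δ * n := by
    have : C / δ ≤ n := hN'.le.trans (by exact_mod_cast h2)
    rw [div_le_iff₀ hδ0] at this
    linarith
  rw [div_le_iff₀ h0, hS]
  have := key n h1
  have := (abs_le.1 (hno n h1)).2
  have : ε = 5 * δ := by rw [hδ]; ring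
  rw [this]
  nlinarith

/-- The control lemma: a sequence whose drift is maximal below and minimal above the running
target has averages converging to the limit of the target. -/
theorem tendsto_average_of_control {x m lo hi τ : ℕ → ℝ} {d : ℕ} {L H t : ℝ}
    (hnoise : Tendsto (fun n : ℕ => (∑ i ∈ Finset.range n, (x i - m i)) / n) atTop (𝓝 0))
    (hlo : Tendsto lo atTop (𝓝 L)) (hhi : Tendsto hi atTop (𝓝 H)) (hLt : L ≤ t) (htH : t ≤ H)
    (hτ : Tendsto τ atTop (𝓝 t)) (hm : ∀ n, d ≤ n → lo n ≤ m n ∧ m n ≤ hi n)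
    (hup : ∀ n, d ≤ n → (∑ i ∈ Finset.range n, x i) / n < τ n → m n = hi n)
    (hdown : ∀ n, d ≤ n → τ n < (∑ i ∈ Finset.range n, x i) / n → m n = lo n) :
    Tendsto (fun n : ℕ => (∑ i ∈ Finset.range n, x i) / (n : ℝ)) atTop (𝓝 t) := by
  obtain ⟨B, hB⟩ := hhi.bddAbove_range
  obtain ⟨B', hB'⟩ := hlo.bddBelow_range
  rw [Metric.tendsto_nhds]
  intro ε hε
  have h1 := eventually_average_le (ε := ε / 2) hnoise hlo hLt hτ (B := B)
    (fun n hn => (hm n hn).2.trans (hB ⟨n, rfl⟩)) hdown (by positivity)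
  have hneg : ∀ n : ℕ, (∑ i ∈ Finset.range n, -x i) / (n : ℝ)
      = -((∑ i ∈ Finset.range n, x i) / n) := fun n => by
    rw [Finset.sum_neg_distrib, neg_div]
  -- The lower bound is the upper bound for the negated sequence, with the roles of `lo` and `hi`
  -- exchanged.
  have h2 := eventually_average_le (x := fun n => -x n) (m := fun n => -m n)
    (lo := fun n => -hi n) (τ := fun n => -τ n) (d := d) (L := -H) (t := -t) (B := -B')
    (ε := ε / 2) (by
      have := hnoise.neg
      rw [neg_zero] at this
      refine this.congr fun n => ?_
      rw [← neg_div, ← Finset.sum_neg_distrib]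
      congr 1
      exact Finset.sum_congr rfl fun i _ => by ring)
    hhi.neg (by linarith) hτ.neg
    (fun n hn => neg_le_neg ((hB' ⟨n, rfl⟩).trans (hm n hn).1))
    (fun n hn h => by
      rw [hneg] at h
      rw [hup n hn (by linarith)]) (by positivity)
  filter_upwards [h1, h2] with n a b
  rw [hneg] at b
  rw [Real.dist_eq, abs_lt]
  constructor <;> linarith

/-! ### Lexicographically maximal points of compact sets -/

theorem exists_lexMax {C : Set (ℕ → ℝ)} (hC : IsCompact C) (hne : C.Nonempty) :
    ∃ p ∈ C, ∀ j, ∀ x ∈ C, (∀ i < j, x i = p i) → x j ≤ p j := by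
  -- `K (j + 1)` retains the points of `K j` with maximal coordinate `j`; any point common to all `K
  -- j` is lexicographically maximal.
  let K : ℕ → Set (ℕ → ℝ) := fun n => Nat.rec C (fun j A => {x ∈ A | ∀ y ∈ A, y j ≤ x j}) n
  have hsucc : ∀ j, K (j + 1) = {x ∈ K j | ∀ y ∈ K j, y j ≤ x j} := fun j => rfl
  have hK : ∀ j, IsCompact (K j) ∧ (K j).Nonempty := by
    intro j
    induction j with
    | zero => exact ⟨hC, hne⟩
    | succ j ih =>
      obtain ⟨z, hz, hmax⟩ := ih.1.exists_isMaxOn ih.2 (continuous_apply j).continuousOn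
      refine ⟨?_, z, hz, fun y hy => hmax hy⟩
      have : K (j + 1) = K j ∩ {x | z j ≤ x j} := by
        ext x
        rw [hsucc]
        exact ⟨fun h => ⟨h.1, h.2 z hz⟩, fun h => ⟨h.1, fun y hy => (hmax hy).trans h.2⟩⟩
      rw [this]
      exact ih.1.inter_right (isClosed_le continuous_const (continuous_apply j))
  obtain ⟨p, hp⟩ := IsCompact.nonempty_iInter_of_sequence_nonempty_isCompact_isClosed K
    (fun j => by rw [hsucc]; exact Set.sep_subset _ _) (fun j => (hK j).2) (hK 0).1
    (fun j => (hK j).1.isClosed)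
  rw [Set.mem_iInter] at hp
  refine ⟨p, hp 0, fun j x hx hxp => ?_⟩
  have hmem : ∀ i, i ≤ j → x ∈ K i := by
    intro i
    induction i with
    | zero => exact fun _ => hx
    | succ i ih =>
      intro hij
      rw [hsucc]
      refine ⟨ih (by omega), fun y hy => ?_⟩
      have := hp (i + 1)
      rw [hsucc] at this
      rw [hxp i (by omega)]
      exact this.2 y hy
  have := hp (j + 1)
  rw [hsucc] at this
  exact this.2 x (hmem j le_rfl)

/-- Penalisation in a compact set: if `f - N * h N` reaches the level `s` for all `N`, where `h` is
nonnegative and monotone, then `f` reaches the level `s` at a common zero of the `h N`. -/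
theorem exists_of_penalty {E : Type*} [TopologicalSpace E] [T2Space E] {C : Set E}
    (hC : IsCompact C) {f : E → ℝ} {h : ℕ → E → ℝ} (hf : Continuous f)
    (hh : ∀ N, Continuous (h N)) (h0 : ∀ N, ∀ x ∈ C, 0 ≤ h N x)
    (hmono : ∀ N, ∀ x ∈ C, h N x ≤ h (N + 1) x) {s : ℝ}
    (hN : ∀ N : ℕ, ∃ x ∈ C, s ≤ f x - N * h N x) :
    ∃ x ∈ C, s ≤ f x ∧ ∀ N, h N x = 0 := by
  -- These superlevel sets decrease with `N` because both the factor and the penalty grow, so they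
  -- have a common point.
  have hcl : ∀ N : ℕ, IsCompact (C ∩ {x | s ≤ f x - N * h N x}) := fun N =>
    hC.inter_right (isClosed_le continuous_const (hf.sub (continuous_const.mul (hh N))))
  obtain ⟨x, hx⟩ := IsCompact.nonempty_iInter_of_sequence_nonempty_isCompact_isClosed
    (fun N : ℕ => C ∩ {x | s ≤ f x - N * h N x})
    (fun N x hx => ⟨hx.1, by
      have h1 := hx.2
      have h2 := h0 N x hx.1
      have h3 := hmono N x hx.1
      simp only [Set.mem_ofPred_eq] at h1 ⊢
      push_cast at h1
      have : (N : ℝ) * h N x ≤ N * h (N + 1) x := by gcongr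
      nlinarith⟩)
    (fun N => by obtain ⟨x, h1, h2⟩ := hN N; exact ⟨x, h1, h2⟩) (hcl 0)
    (fun N => (hcl N).isClosed)
  rw [Set.mem_iInter] at hx
  have hxC : x ∈ C := (hx 0).1
  refine ⟨x, hxC, by simpa using (hx 0).2, fun N => le_antisymm ?_ (h0 N x hxC)⟩
  by_contra! hpos
  obtain ⟨n, hn⟩ := exists_nat_gt ((f x - s) / h N x)
  have hmon : ∀ k, h N x ≤ h (N + k) x := fun k => by
    induction k with
    | zero => rfl
    | succ k ih => exact ih.trans (hmono (N + k) x hxC)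
  have h1 : s ≤ f x - ((N + n : ℕ) : ℝ) * h (N + n) x := (hx (N + n)).2
  rw [div_lt_iff₀ hpos] at hn
  have h2 : (n : ℝ) * h N x ≤ ((N + n : ℕ) : ℝ) * h (N + n) x := by
    have := hmon n
    push_cast
    gcongr
    linarith [(Nat.cast_nonneg N : (0 : ℝ) ≤ N)]
  linarith

/-- A lexicographically maximal point of the first coordinates extends to a point where all the
(nonnegative) second coordinates vanish, provided that penalising the latter does not lower the
support function of the former. -/
theorem exists_extension {C : Set (ℕ ⊕ ℕ → ℝ)} (hC : IsCompact C) {p : ℕ → ℝ}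
    (hp : ∀ j, ∀ x ∈ C, (∀ i < j, x (.inl i) = p i) → x (.inl j) ≤ p j)
    (h0 : ∀ x ∈ C, ∀ n, 0 ≤ x (.inr n))
    (hN : ∀ (a : ℕ →₀ ℝ) (N : ℕ), ∃ x ∈ C, (a.sum fun i r => r * p i) ≤
      (a.sum fun i r => r * x (.inl i)) - N * ∑ n ∈ Finset.range N, x (.inr n)) :
    ∃ x ∈ C, (∀ i, x (.inl i) = p i) ∧ ∀ n, x (.inr n) = 0 := by
  have hcont : ∀ a : ℕ →₀ ℝ,
      Continuous fun x : ℕ ⊕ ℕ → ℝ => a.sum fun i r => r * x (.inl i) := fun a =>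
    continuous_finsetSum _ fun i _ => continuous_const.mul (continuous_apply _)
  let A : ℕ → Set (ℕ ⊕ ℕ → ℝ) := fun J =>
    {x ∈ C | (∀ i < J, x (.inl i) = p i) ∧ ∀ n, x (.inr n) = 0}
  have hA : ∀ J, IsCompact (A J) := by
    intro J
    have : A J = C ∩ ((⋂ i, ⋂ (_ : i < J), {x | x (.inl i) = p i}) ∩
        ⋂ n, {x | x (.inr n) = 0}) := by
      ext x
      simp only [A, Set.mem_ofPred_eq, Set.mem_inter_iff, Set.mem_iInter]
    rw [this]
    refine hC.inter_right (IsClosed.inter ?_ ?_)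
    · exact isClosed_iInter fun i => isClosed_iInter fun _ =>
        isClosed_eq (continuous_apply _) continuous_const
    · exact isClosed_iInter fun n => isClosed_eq (continuous_apply _) continuous_const
  -- The inequality is carried for every linear functional `a`, so that the induction step may alter
  -- the coefficient of coordinate `J`.
  have key : ∀ J, ∀ a : ℕ →₀ ℝ, ∃ x ∈ A J,
      (a.sum fun i r => r * p i) ≤ a.sum fun i r => r * x (.inl i) := by
    intro J
    induction J with
    | zero =>
      intro a
      obtain ⟨x, hx, h1, h2⟩ := exists_of_penalty hC (hcont a)
        (h := fun N x => ∑ n ∈ Finset.range N, x (.inr n))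
        (fun N => continuous_finsetSum _ fun n _ => continuous_apply _)
        (fun N x hx => Finset.sum_nonneg fun n _ => h0 x hx n)
        (fun N x hx => by rw [Finset.sum_range_succ]; linarith [h0 x hx N]) (hN a)
      refine ⟨x, ⟨hx, by simp, fun n => ?_⟩, h1⟩
      have := h2 (n + 1)
      rw [Finset.sum_range_succ, h2 n, zero_add] at this
      exact this
    | succ J ih =>
      intro a
      obtain ⟨x, hx, h1, h2⟩ := exists_of_penalty (hA J) (hcont a)
        -- On `A J` this penalty is nonnegative by lexicographic maximality. Raising the coefficient
        -- of `J` by `N` in the induction hypothesis subtracts exactly `N` times it.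
        (h := fun _ x => p J - x (.inl J)) (s := a.sum fun i r => r * p i)
        (fun _ => continuous_const.sub (continuous_apply _))
        (fun _ x hx => sub_nonneg.2 (hp J x hx.1 hx.2.1)) (fun _ _ _ => le_rfl) (fun N => by
          obtain ⟨x, hx, h⟩ := ih (a + Finsupp.single J (N : ℝ))
          refine ⟨x, hx, ?_⟩
          rw [Finsupp.sum_add_index' (by simp) (by intros; ring),
            Finsupp.sum_add_index' (by simp) (by intros; ring),
            Finsupp.sum_single_index (by simp), Finsupp.sum_single_index (by simp)] at h
          linarith)
      refine ⟨x, ⟨hx.1, fun i hi => ?_, hx.2.2⟩, h1⟩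
      rcases Nat.lt_succ_iff_lt_or_eq.1 hi with h | rfl
      · exact hx.2.1 i h
      · linarith [h2 0]
  obtain ⟨x, hx⟩ := IsCompact.nonempty_iInter_of_sequence_nonempty_isCompact_isClosed A
    (fun J x hx => ⟨hx.1, fun i hi => hx.2.1 i (by omega), hx.2.2⟩)
    (fun J => let ⟨x, hx, _⟩ := key J 0; ⟨x, hx⟩) (hA 0) (fun J => (hA J).isClosed)
  rw [Set.mem_iInter] at hx
  exact ⟨x, (hx 0).1, fun i => (hx (i + 1)).2.1 i (Nat.lt_succ_self i), (hx 0).2.2⟩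

/-! ### Lipschitz regularisation -/

section Regularisation

variable {E : Type*} [PseudoMetricSpace E] {f : E → ℝ} {M : ℝ}

/-- The largest `k`-Lipschitz minorant of `f`. -/
def lipLower (f : E → ℝ) (k : ℕ) (x : E) : ℝ := ⨅ y, (f y + k * dist x y)

theorem bddBelow_lipLower (hM : ∀ x, |f x| ≤ M) (k : ℕ) (x : E) :
    BddBelow (Set.range fun y => f y + k * dist x y) := by
  refine ⟨-M, ?_⟩
  rintro _ ⟨y, rfl⟩
  have := (abs_le.1 (hM y)).1
  have : 0 ≤ (k : ℝ) * dist x y := by positivity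
  dsimp only
  linarith

theorem lipLower_le (hM : ∀ x, |f x| ≤ M) (k : ℕ) (x : E) : lipLower f k x ≤ f x :=
  (ciInf_le (bddBelow_lipLower hM k x) x).trans (by simp)

theorem abs_lipLower_le (hM : ∀ x, |f x| ≤ M) (k : ℕ) (x : E) : |lipLower f k x| ≤ M := by
  have : Nonempty E := ⟨x⟩
  refine abs_le.2 ⟨le_ciInf fun y => ?_, (lipLower_le hM k x).trans (abs_le.1 (hM x)).2⟩
  have := (abs_le.1 (hM y)).1
  have : 0 ≤ (k : ℝ) * dist x y := by positivity
  linarith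

theorem lipLower_sub_le (hM : ∀ x, |f x| ≤ M) (k : ℕ) (x y : E) :
    |lipLower f k x - lipLower f k y| ≤ k * dist x y := by
  have : Nonempty E := ⟨x⟩
  have key : ∀ x y : E, lipLower f k x - lipLower f k y ≤ k * dist x y := by
    intro x y
    rw [sub_le_comm]
    refine le_ciInf fun z => ?_
    have h1 := ciInf_le (bddBelow_lipLower hM k x) z
    have h2 : (k : ℝ) * dist x z ≤ k * dist x y + k * dist y z := by
      rw [← mul_add]
      exact mul_le_mul_of_nonneg_left (dist_triangle _ _ _) (Nat.cast_nonneg k)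
    unfold lipLower
    linarith
  refine abs_le.2 ⟨?_, key x y⟩
  have := key y x
  rw [dist_comm] at this
  linarith

theorem lipLower_mono (hM : ∀ x, |f x| ≤ M) {k l : ℕ} (hkl : k ≤ l) (x : E) :
    lipLower f k x ≤ lipLower f l x :=
  ciInf_mono (bddBelow_lipLower hM k x) fun y => by gcongr

theorem tendsto_lipLower (hM : ∀ x, |f x| ≤ M) (hf : Continuous f) (x : E) :
    Tendsto (fun k => lipLower f k x) atTop (𝓝 (f x)) := by
  have : Nonempty E := ⟨x⟩
  rw [tendsto_order]
  refine ⟨fun a ha => ?_, fun a ha => Eventually.of_forall fun k => (lipLower_le hM k x).trans_lt ha⟩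
  obtain ⟨b, hab, hb⟩ := exists_between ha
  obtain ⟨δ, hδ, hball⟩ := Metric.eventually_nhds_iff.1 (hf.continuousAt.eventually_const_lt hb)
  -- From slope `K` on, points at distance at least `δ` cost more than `b + M` and cannot push the
  -- infimum below `b`.
  obtain ⟨K, hK⟩ := exists_nat_gt ((b + M) / δ)
  filter_upwards [eventually_ge_atTop K] with k hk
  refine hab.trans_le (le_ciInf fun y => ?_)
  rcases lt_or_ge (dist y x) δ with h | h
  · have := hball h
    have : 0 ≤ (k : ℝ) * dist x y := by positivity
    linarith
  · have h1 := (abs_le.1 (hM y)).1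
    rw [div_lt_iff₀ hδ] at hK
    have h2 : (K : ℝ) * δ ≤ k * dist x y := by
      rw [dist_comm]
      gcongr
    linarith

theorem bddLip_lipLower (hM : ∀ x, |f x| ≤ M) (k : ℕ) : BddLip (lipLower f k) :=
  BddLip.of_dist_le (lipLower_sub_le hM k) (abs_lipLower_le hM k)

end Regularisation

/-! ### Almost everywhere approximation from summable `L¹` errors -/

/-- The sum of the errors has a finite integral, hence is finite almost everywhere, and the terms of
a convergent series tend to zero. -/
theorem ae_tendsto_of_tsum_lintegral {α : Type*} [MeasurableSpace α] {μ : Measure α}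
    {g : ℕ → α → ℝ} {φ : α → ℝ} (hg : ∀ k, Measurable (g k)) (hφ : Measurable φ)
    (h : ∑' k, ∫⁻ x, ENNReal.ofReal |φ x - g k x| ∂μ ≠ ∞) :
    ∀ᵐ x ∂μ, Tendsto (fun k => g k x) atTop (𝓝 (φ x)) := by
  have hm : ∀ k, Measurable fun x => ENNReal.ofReal |φ x - g k x| := fun k =>
    ((hφ.sub (hg k)).abs).ennreal_ofReal
  rw [← lintegral_tsum fun k => (hm k).aemeasurable] at h
  filter_upwards [ae_lt_top (Measurable.tsum hm) h] with x hx
  have h1 := ENNReal.tendsto_atTop_zero_of_tsum_ne_top hx.ne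
  have h2 := (ENNReal.tendsto_toReal ENNReal.zero_ne_top).comp h1
  rw [tendsto_iff_dist_tendsto_zero]
  refine h2.congr fun k => ?_
  simp [Real.dist_eq, abs_sub_comm]

/-- A bounded measurable function is the almost everywhere limit of a sequence of bounded Lipschitz
functions. -/
theorem exists_bddLip_tendsto_ae {E : Type*} [PseudoMetricSpace E] [MeasurableSpace E]
    [BorelSpace E] (μ : Measure E) [IsFiniteMeasure μ] {φ : E → ℝ} (hφ : Measurable φ) {a b : ℝ}
    (hab : ∀ x, a ≤ φ x ∧ φ x ≤ b) :
    ∃ g : ℕ → E → ℝ, (∀ k, BddLip (g k)) ∧ (∀ k x, g k x ∈ Set.Icc a (max a b)) ∧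
      ∀ᵐ x ∂μ, Tendsto (fun k => g k x) atTop (𝓝 (φ x)) := by
  have hint : Integrable φ μ := by
    refine Integrable.of_bound hφ.aestronglyMeasurable (max |a| |b|)
      (Eventually.of_forall fun x => ?_)
    exact abs_le_max_abs_abs (hab x).1 (hab x).2
  have key : ∀ k : ℕ, ∃ g : E → ℝ, BddLip g ∧
      ∫⁻ x, ENNReal.ofReal |φ x - g x| ∂μ ≤ (2⁻¹ : ℝ≥0∞) ^ k + 2⁻¹ ^ k := by
    intro k
    have hk : (2⁻¹ : ℝ≥0∞) ^ k ≠ 0 := by simp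
    obtain ⟨f, hf, -⟩ := (memLp_one_iff_integrable.2 hint).exists_boundedContinuous_eLpNorm_sub_le
      ENNReal.one_ne_top hk
    rw [eLpNorm_one_eq_lintegral_enorm] at hf
    have hfM : ∀ x, |f x| ≤ ‖f‖ := fun x => f.norm_coe_le_norm x
    have hlim : Tendsto (fun j => ∫⁻ x, ENNReal.ofReal |f x - lipLower f j x| ∂μ) atTop (𝓝 0) := by
      have := tendsto_lintegral_of_dominated_convergence (μ := μ)
        (F := fun j x => ENNReal.ofReal |f x - lipLower f j x|) (f := fun _ => 0)
        (fun _ => ENNReal.ofReal (2 * ‖f‖))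
        (fun j => ((f.continuous.measurable.sub
          (bddLip_lipLower hfM j).continuous.measurable).abs).ennreal_ofReal)
        (fun j => Eventually.of_forall fun x => ENNReal.ofReal_le_ofReal (by
          have h1 := abs_sub (f x) (lipLower f j x)
          linarith [hfM x, abs_lipLower_le hfM j x]))
        (by simp [ENNReal.mul_eq_top])
        (Eventually.of_forall fun x => by
          have h1 := (tendsto_const_nhds (x := f x)).sub (tendsto_lipLower hfM f.continuous x)
          rw [sub_self] at h1
          simpa [Function.comp_def] using (ENNReal.continuous_ofReal.tendsto _).comp h1.abs)
      simpa using this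
    obtain ⟨j, hj⟩ := (hlim.eventually_lt_const (pos_iff_ne_zero.2 hk)).exists
    refine ⟨lipLower f j, bddLip_lipLower hfM j, ?_⟩
    calc ∫⁻ x, ENNReal.ofReal |φ x - lipLower f j x| ∂μ
        ≤ ∫⁻ x, (‖(φ - (f : E → ℝ)) x‖ₑ + ENNReal.ofReal |f x - lipLower f j x|) ∂μ := by
          refine lintegral_mono fun x => ?_
          rw [← ofReal_norm, ← ENNReal.ofReal_add (norm_nonneg _) (abs_nonneg _)]
          exact ENNReal.ofReal_le_ofReal (abs_sub_le _ _ _)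
      _ = ∫⁻ x, ‖(φ - (f : E → ℝ)) x‖ₑ ∂μ + ∫⁻ x, ENNReal.ofReal |f x - lipLower f j x| ∂μ :=
          lintegral_add_left (hφ.sub f.continuous.measurable).enorm _
      _ ≤ _ := add_le_add hf hj.le
  choose g hg hgi using key
  have hae := ae_tendsto_of_tsum_lintegral (μ := μ) (fun k => (hg k).continuous.measurable) hφ
    (ne_top_of_le_ne_top (by
      rw [ENNReal.tsum_add, ENNReal.tsum_geometric]
      simp) (ENNReal.tsum_le_tsum hgi))
  -- Clamping is continuous and fixes the values of `φ`. The upper bound is `max a b` since `a ≤ b`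
  -- is not available when `E` is empty.
  refine ⟨fun k x => max a (min (g k x) b), fun k => BddLip.clamp a b (hg k).1.choose_spec,
    fun k x => ⟨le_max_left _ _, max_le_max le_rfl (min_le_right _ _)⟩, ?_⟩
  filter_upwards [hae] with x hx
  have h1 := ((lipschitzWith_clamp a b).continuous.tendsto (φ x)).comp hx
  rw [min_eq_left (hab x).2, max_eq_right (hab x).1] at h1
  exact h1

/-! ### Conditional means of the coordinate process -/

/-- The first `n` coordinates of a sequence. -/
def restr (n : ℕ) (x : ℕ → ℝ) : Fin n → ℝ := fun i => x i

theorem continuous_restr (n : ℕ) : Continuous (restr n) :=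
  continuous_pi fun i => continuous_apply (i : ℕ)

theorem measurable_restr (n : ℕ) : Measurable (restr n) := (continuous_restr n).measurable

/-- The filtration in which the `n`-th σ-algebra is generated by the first `n` coordinates. -/
def coordFiltration : Filtration ℕ (inferInstance : MeasurableSpace (ℕ → ℝ)) where
  seq n := MeasurableSpace.comap (restr n) inferInstance
  mono' n k hnk := by
    have : restr n = (fun (y : Fin k → ℝ) (i : Fin n) => y (Fin.castLE hnk i)) ∘ restr k := rfl
    change MeasurableSpace.comap (restr n) _ ≤ MeasurableSpace.comap (restr k) _
    rw [this, ← MeasurableSpace.comap_comp]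
    exact MeasurableSpace.comap_mono
      (measurable_pi_lambda _ fun i => measurable_pi_apply _).comap_le
  le' n := (measurable_restr n).comap_le

theorem measurable_restr_coordFiltration (n : ℕ) : Measurable[coordFiltration n] (restr n) :=
  comap_measurable (restr n)

theorem measurable_apply_coordFiltration {i n : ℕ} (h : i < n) :
    Measurable[coordFiltration n] (fun x : ℕ → ℝ => x i) :=
  (measurable_pi_apply (⟨i, h⟩ : Fin n)).comp (measurable_restr_coordFiltration n)

section Conditional

variable {Q : Measure (ℕ → ℝ)} [IsProbabilityMeasure Q]

theorem memLp_of_abs_le {Z : (ℕ → ℝ) → ℝ} (hZ : Measurable Z) {M : ℝ} (hM : ∀ x, |Z x| ≤ M)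
    (p : ℝ≥0∞) : MemLp Z p Q :=
  MemLp.of_bound hZ.aestronglyMeasurable M (Eventually.of_forall hM)

theorem integrable_of_abs_le {Z : (ℕ → ℝ) → ℝ} (hZ : Measurable Z) {M : ℝ}
    (hM : ∀ x, |Z x| ≤ M) : Integrable Z Q :=
  Integrable.of_bound hZ.aestronglyMeasurable M (Eventually.of_forall hM)

theorem integral_mul_condExp {n : ℕ} {s Z : (ℕ → ℝ) → ℝ}
    (hs : StronglyMeasurable[coordFiltration n] s) (hs2 : MemLp s 2 Q) (hZ : MemLp Z 2 Q) :
    ∫ x, s x * (Q[Z|coordFiltration n]) x ∂Q = ∫ x, s x * Z x ∂Q := by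
  have h1 := condExp_mul_of_stronglyMeasurable_left hs (hs2.integrable_mul hZ)
    (hZ.integrable one_le_two)
  have h2 := integral_condExp (μ := Q) (f := s * Z) (coordFiltration.le n)
  rw [integral_congr_ae h1] at h2
  exact h2

/-- If a bounded variable has nonpositive correlation with all nonnegative bounded Lipschitz
functions of the first `n` coordinates, then its conditional expectation is nonpositive. -/
theorem condExp_nonpos {n : ℕ} {Z : (ℕ → ℝ) → ℝ} (hZ : Measurable Z) {M : ℝ}
    (hM : ∀ x, |Z x| ≤ M)
    (h : ∀ g : (Fin n → ℝ) → ℝ, BddLip g → (∀ y, 0 ≤ g y) → ∫ x, g (restr n x) * Z x ∂Q ≤ 0) :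
    ∀ᵐ x ∂Q, (Q[Z|coordFiltration n]) x ≤ 0 := by
  have hint : Integrable Z Q := integrable_of_abs_le hZ hM
  have hset : ∀ A : Set (Fin n → ℝ), MeasurableSet A → ∫ x in restr n ⁻¹' A, Z x ∂Q ≤ 0 := by
    intro A hA
    have : IsFiniteMeasure (Q.map (restr n)) := inferInstance
    obtain ⟨g, hg, hg01, hgt⟩ := exists_bddLip_tendsto_ae (Q.map (restr n))
      (φ := A.indicator fun _ => (1 : ℝ)) (measurable_const.indicator hA) (a := 0) (b := 1)
      (fun x => ⟨Set.indicator_nonneg (fun _ _ => zero_le_one) x,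
        Set.indicator_le_self' (fun _ _ => zero_le_one) x⟩)
    rw [max_eq_right zero_le_one] at hg01
    have hgt' := ae_of_ae_map (measurable_restr n).aemeasurable hgt
    have hlim : Tendsto (fun k => ∫ x, g k (restr n x) * Z x ∂Q) atTop
        (𝓝 (∫ x, A.indicator (fun _ => (1 : ℝ)) (restr n x) * Z x ∂Q)) := by
      refine tendsto_integral_of_dominated_convergence (fun _ => M)
        (fun k => (((hg k).continuous.measurable.comp (measurable_restr n)).mul
          hZ).aestronglyMeasurable) (integrable_const _)
        (fun k => Eventually.of_forall fun x => ?_) ?_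
      · have h1 := hg01 k (restr n x)
        rw [Real.norm_eq_abs, abs_mul, abs_of_nonneg h1.1]
        have := hM x
        nlinarith [abs_nonneg (Z x), h1.2]
      · filter_upwards [hgt'] with x hx
        exact hx.mul_const _
    have hle := le_of_tendsto' hlim fun k => h (g k) (hg k) fun y => (hg01 k y).1
    rw [← integral_indicator (measurable_restr n hA)]
    refine le_of_eq_of_le (integral_congr_ae (Eventually.of_forall fun x => ?_)) hle
    by_cases hx : restr n x ∈ A
    · simp [Set.indicator, hx]
    · simp [Set.indicator, hx]
  set G := Q[Z|coordFiltration n] with hG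
  have hGm : StronglyMeasurable[coordFiltration n] G := stronglyMeasurable_condExp
  have hs : MeasurableSet[coordFiltration n] {x | 0 < G x} :=
    hGm.measurable measurableSet_Ioi
  obtain ⟨A, hA, hAs⟩ := id hs
  -- The set where the conditional expectation is positive is itself an event of the first `n`
  -- coordinates; the integral there is both nonpositive and nonnegative, so that set is null.
  have h1 : ∫ x in {x | 0 < G x}, G x ∂Q ≤ 0 := by
    rw [setIntegral_condExp (coordFiltration.le n) hint hs, ← hAs]
    exact hset A hA
  have hs' := coordFiltration.le n _ hs
  have h2 : 0 ≤ᵐ[Q.restrict {x | 0 < G x}] G := by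
    rw [EventuallyLE, ae_restrict_iff' hs']
    exact Eventually.of_forall fun x hx => (le_of_lt hx)
  have h3 := (integral_eq_zero_iff_of_nonneg_ae h2 integrable_condExp.integrableOn).1
    (le_antisymm h1 (integral_nonneg_of_ae h2))
  rw [EventuallyEq, ae_restrict_iff' hs'] at h3
  filter_upwards [h3] with x hx
  by_contra! hpos
  exact hpos.ne' (hx hpos)

/-- The strong law for the deviations from the conditional means. -/
theorem tendsto_average_sub_condExp {T : ℕ → (ℕ → ℝ) → ℝ} {c : ℕ → ℝ}
    (hT : ∀ n, Measurable[coordFiltration (n + 1)] (T n)) (hTc : ∀ n x, |T n x| ≤ c n)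
    (hsum : Summable fun n : ℕ => (∫ x, T n x ^ 2 ∂Q) / ((n : ℝ) + 1) ^ 2) :
    ∀ᵐ x ∂Q, Tendsto (fun n : ℕ =>
      (∑ i ∈ Finset.range n, (T i x - (Q[T i|coordFiltration i]) x)) / n) atTop (𝓝 0) := by
  have hTm : ∀ n, Measurable (T n) := fun n => (hT n).mono (coordFiltration.le _) le_rfl
  have hT2 : ∀ n, MemLp (T n) 2 Q := fun n => memLp_of_abs_le (hTm n) (hTc n) 2
  set m : ℕ → (ℕ → ℝ) → ℝ := fun n => Q[T n|coordFiltration n] with hm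
  have hmm : ∀ n, StronglyMeasurable[coordFiltration n] (m n) := fun n =>
    stronglyMeasurable_condExp
  have hm2 : ∀ n, MemLp (m n) 2 Q := fun n => (hT2 n).condExp one_le_two
  set f : ℕ → (ℕ → ℝ) → ℝ := fun n x => ∑ i ∈ Finset.range n, (T i x - m i x) / (i + 1) with hf
  have hfsucc : ∀ n x, f (n + 1) x = f n x + (T n x - m n x) / (n + 1) := fun n x => by
    simp only [hf, Finset.sum_range_succ]
  have hadp : StronglyAdapted coordFiltration f := by
    intro n
    refine Measurable.stronglyMeasurable ?_
    refine Finset.measurable_fun_sum _ fun i hi => ?_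
    have hi' := Finset.mem_range.1 hi
    exact (((hT i).mono (coordFiltration.mono hi') le_rfl).sub
      ((hmm i).measurable.mono (coordFiltration.mono hi'.le) le_rfl)).div_const _
  have hξ2 : ∀ n : ℕ, MemLp (fun x => (T n x - m n x) / ((n : ℝ) + 1)) 2 Q := fun n => by
    have := ((hT2 n).sub (hm2 n)).const_mul ((n : ℝ) + 1)⁻¹
    refine this.congr_norm this.1 (Eventually.of_forall fun x => ?_) |>.ae_eq
      (Eventually.of_forall fun x => ?_)
    · rfl
    · simp [div_eq_inv_mul]
  have hf2 : ∀ n, MemLp (f n) 2 Q := fun n => memLp_finsetSum _ fun i _ => hξ2 i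
  have hmart : Martingale f coordFiltration Q := by
    refine martingale_of_condExp_sub_eq_zero_nat hadp
      (fun n => (hf2 n).integrable one_le_two) fun n => ?_
    have h1 : f (n + 1) - f n = ((n : ℝ) + 1)⁻¹ • (T n - m n) := by
      ext x
      simp only [Pi.sub_apply, Pi.smul_apply, smul_eq_mul, hfsucc]
      rw [div_eq_inv_mul]
      ring
    rw [h1]
    have h2 := condExp_sub ((hT2 n).integrable one_le_two) ((hm2 n).integrable one_le_two)
      (coordFiltration n)
    rw [condExp_of_stronglyMeasurable (coordFiltration.le n) (hmm n)
      ((hm2 n).integrable one_le_two)] at h2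
    filter_upwards [condExp_smul (μ := Q) ((n : ℝ) + 1)⁻¹ (T n - m n) (coordFiltration n), h2]
      with x hx hx2
    rw [hx, Pi.smul_apply, hx2]
    simp [hm]
  -- Martingale increments are orthogonal to the past, and centring at the conditional mean can only
  -- reduce the second moment.
  have hsq : ∀ n, ∫ x, f n x ^ 2 ∂Q ≤
      ∑ i ∈ Finset.range n, (∫ x, T i x ^ 2 ∂Q) / ((i : ℝ) + 1) ^ 2 := by
    intro n
    induction n with
    | zero => simp [hf]
    | succ n ih =>
      rw [Finset.sum_range_succ]
      refine le_trans ?_ (add_le_add_left ih _)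
      have e1 := integral_mul_condExp (Q := Q) (hadp n) (hf2 n) (hT2 n)
      have e2 := integral_mul_condExp (Q := Q) (hmm n) (hm2 n) (hT2 n)
      change ∫ x, f n x * m n x ∂Q = _ at e1
      change ∫ x, m n x * m n x ∂Q = _ at e2
      have i1 : Integrable (fun x => f n x ^ 2) Q := (hf2 n).integrable_sq
      have i2 : Integrable (fun x => f n x * T n x) Q := (hf2 n).integrable_mul (hT2 n)
      have i3 : Integrable (fun x => f n x * m n x) Q := (hf2 n).integrable_mul (hm2 n)
      have i4 : Integrable (fun x => T n x ^ 2) Q := (hT2 n).integrable_sq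
      have i5 : Integrable (fun x => m n x * T n x) Q := (hm2 n).integrable_mul (hT2 n)
      have i6 : Integrable (fun x => m n x * m n x) Q := (hm2 n).integrable_mul (hm2 n)
      have hpos : 0 ≤ ∫ x, m n x * m n x ∂Q := integral_nonneg fun x => mul_self_nonneg _
      have hexp : ∀ x, f (n + 1) x ^ 2 = f n x ^ 2
          + (2 / ((n : ℝ) + 1)) * (f n x * T n x - f n x * m n x)
          + (1 / ((n : ℝ) + 1) ^ 2) * (T n x ^ 2 - 2 * (m n x * T n x) + m n x * m n x) := by
        intro x
        rw [hfsucc]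
        have : (n : ℝ) + 1 ≠ 0 := by positivity
        field_simp
        ring
      simp only [hexp]
      have j1 : Integrable (fun x => 2 / ((n : ℝ) + 1) * (f n x * T n x - f n x * m n x)) Q :=
        (i2.sub i3).const_mul _
      have j2 : Integrable (fun x => T n x ^ 2 - 2 * (m n x * T n x)) Q :=
        i4.sub (i5.const_mul 2)
      have j3 : Integrable (fun x => 1 / ((n : ℝ) + 1) ^ 2 *
          (T n x ^ 2 - 2 * (m n x * T n x) + m n x * m n x)) Q := (j2.add i6).const_mul _
      have j4 : Integrable (fun x => f n x ^ 2 +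
          2 / ((n : ℝ) + 1) * (f n x * T n x - f n x * m n x)) Q := i1.add j1
      rw [integral_add j4 j3, integral_add i1 j1, integral_const_mul, integral_const_mul,
        integral_sub i2 i3, integral_add j2 i6, integral_sub i4 (i5.const_mul 2),
        integral_const_mul, e1, sub_self, mul_zero, add_zero,
        ← e2, one_div, ← div_eq_inv_mul]
      gcongr
      linarith
  set R := ∑' n : ℕ, (∫ x, T n x ^ 2 ∂Q) / ((n : ℝ) + 1) ^ 2 with hR
  have hbdd : ∀ n, eLpNorm (f n) 1 Q ≤ ((R + 1).toNNReal : ℝ≥0∞) := by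
    intro n
    have hfi := (hf2 n).integrable one_le_two
    rw [eLpNorm_one_eq_lintegral_enorm, ← ofReal_integral_norm_eq_lintegral_enorm hfi]
    refine ENNReal.ofReal_le_ofReal ?_
    -- The `L²` bound becomes the `L¹` bound required by martingale convergence through `|a| ≤ a ^ 2
    -- + 1`.
    have h1 : ∫ x, ‖f n x‖ ∂Q ≤ ∫ x, (f n x ^ 2 + 1) ∂Q := by
      refine integral_mono hfi.norm ((hf2 n).integrable_sq.add (integrable_const 1)) fun x => ?_
      rw [Real.norm_eq_abs]
      nlinarith [sq_abs (f n x), sq_nonneg (|f n x| - 1)]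
    rw [integral_add (hf2 n).integrable_sq (integrable_const 1)] at h1
    simp only [integral_const, probReal_univ, smul_eq_mul, one_mul] at h1
    have h2 := hsum.sum_le_tsum (Finset.range n) fun i _ =>
      div_nonneg (integral_nonneg fun x => sq_nonneg (T i x)) (by positivity)
    linarith [hsq n]
  filter_upwards [hmart.submartingale.ae_tendsto_limitProcess hbdd] with x hx
  exact kronecker hx

/-- Suppose that the conditional means of the truncated coordinates are bounded by `lo` and `hi`
and that the control `σ` is exploited optimally. Then, up to an error whose averages vanish, the
increments are driven by a drift which is extremal according to the sign of the control. -/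
theorem ae_exists_drift {d : ℕ} {lo hi : ℕ → ℝ}
    (hup : ∀ n, d ≤ n → ∀ g : (Fin n → ℝ) → ℝ, BddLip g → (∀ y, 0 ≤ g y) →
      ∫ x, g (restr n x) * (clip n (x n) - hi n) ∂Q ≤ 0)
    (hlow : ∀ n, d ≤ n → ∀ g : (Fin n → ℝ) → ℝ, BddLip g → (∀ y, 0 ≤ g y) →
      ∫ x, g (restr n x) * (lo n - clip n (x n)) ∂Q ≤ 0)
    {σ : ∀ n, (Fin n → ℝ) → ℝ} (hσ : ∀ n, BddLip (σ n))
    (hD : ∀ n, d ≤ n → ∫ x, (max (σ n (restr n x)) 0 * hi n - max (-σ n (restr n x)) 0 * lo n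
      - σ n (restr n x) * clip n (x n)) ∂Q = 0)
    (hsum : Summable fun n : ℕ => (∫ x, clip n (x n) ^ 2 ∂Q) / ((n : ℝ) + 1) ^ 2)
    (hBC : ∑' n : ℕ, Q {x | (n : ℝ) < |x n|} ≠ ∞) :
    ∀ᵐ x ∂Q, ∃ m : ℕ → ℝ,
      Tendsto (fun n : ℕ => (∑ i ∈ Finset.range n, (x i - m i)) / n) atTop (𝓝 0) ∧
      ∀ n, d ≤ n → (lo n ≤ m n ∧ m n ≤ hi n) ∧ (0 < σ n (restr n x) → m n = hi n) ∧
        (σ n (restr n x) < 0 → m n = lo n) := by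
  set T : ℕ → (ℕ → ℝ) → ℝ := fun n x => clip n (x n) with hTdef
  have hT : ∀ n, Measurable[coordFiltration (n + 1)] (T n) := fun n =>
    (continuous_clip n).measurable.comp (measurable_apply_coordFiltration (Nat.lt_succ_self n))
  have hTm : ∀ n, Measurable (T n) := fun n => (hT n).mono (coordFiltration.le _) le_rfl
  have hTc : ∀ n x, |T n x| ≤ (n : ℝ) := fun n x => abs_clip_le (Nat.cast_nonneg n) _
  have hT2 : ∀ n, MemLp (T n) 2 Q := fun n => memLp_of_abs_le (hTm n) (hTc n) 2
  have hTi : ∀ n, Integrable (T n) Q := fun n => integrable_of_abs_le (hTm n) (hTc n)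
  have hhi : ∀ n, d ≤ n → ∀ᵐ x ∂Q, (Q[T n|coordFiltration n]) x ≤ hi n := by
    intro n hn
    have h1 := condExp_nonpos (Q := Q) (Z := fun x => T n x - hi n) ((hTm n).sub_const _)
      (M := n + |hi n|) (fun x => (abs_sub _ _).trans (add_le_add (hTc n x) le_rfl)) (hup n hn)
    have h2 := condExp_sub (hTi n) (integrable_const (hi n)) (coordFiltration n)
    filter_upwards [h1, h2] with x hx hx2
    rw [show (fun x => T n x - hi n) = T n - fun _ => hi n from rfl, hx2, Pi.sub_apply,
      condExp_const (coordFiltration.le n)] at hx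
    linarith
  have hlo : ∀ n, d ≤ n → ∀ᵐ x ∂Q, lo n ≤ (Q[T n|coordFiltration n]) x := by
    intro n hn
    have h1 := condExp_nonpos (Q := Q) (Z := fun x => lo n - T n x) ((hTm n).const_sub _)
      (M := |lo n| + n) (fun x => (abs_sub _ _).trans (add_le_add le_rfl (hTc n x))) (hlow n hn)
    have h2 := condExp_sub (integrable_const (lo n)) (hTi n) (coordFiltration n)
    filter_upwards [h1, h2] with x hx hx2
    rw [show (fun x => lo n - T n x) = (fun _ => lo n) - T n from rfl, hx2, Pi.sub_apply,
      condExp_const (coordFiltration.le n)] at hx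
    linarith
  -- Replacing the clipped coordinate by its conditional mean preserves the integral, but makes the
  -- integrand nonnegative, since the conditional mean lies between `lo n` and `hi n`. A zero
  -- integral then forces it to vanish.
  have hopt : ∀ n, d ≤ n → ∀ᵐ x ∂Q, max (σ n (restr n x)) 0 * hi n
      - max (-σ n (restr n x)) 0 * lo n
      - σ n (restr n x) * (Q[T n|coordFiltration n]) x = 0 := by
    intro n hn
    obtain ⟨-, M, -, hM0, -, hM⟩ := (hσ n).exists_bounds
    have hsm : Measurable[coordFiltration n] fun x => σ n (restr n x) :=
      (hσ n).continuous.measurable.comp (measurable_restr_coordFiltration n)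
    have hsm' : Measurable fun x => σ n (restr n x) := hsm.mono (coordFiltration.le n) le_rfl
    have hs2 : MemLp (fun x => σ n (restr n x)) 2 Q := memLp_of_abs_le hsm' (fun x => hM _) 2
    have hgi : Integrable (fun x => max (σ n (restr n x)) 0 * hi n
        - max (-σ n (restr n x)) 0 * lo n) Q := by
      refine integrable_of_abs_le (M := M * |hi n| + M * |lo n|)
        (((hsm'.max measurable_const).mul_const _).sub
          ((hsm'.neg.max measurable_const).mul_const _)) fun x => ?_
      have hb := abs_le.1 (hM (restr n x))
      refine (abs_sub _ _).trans ?_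
      rw [abs_mul, abs_mul, abs_of_nonneg (le_max_right (σ n (restr n x)) 0),
        abs_of_nonneg (le_max_right (-σ n (restr n x)) 0)]
      gcongr
      · exact max_le hb.2 hM0
      · exact max_le (by linarith) hM0
    have hi1 : Integrable (fun x => σ n (restr n x) * T n x) Q := hs2.integrable_mul (hT2 n)
    have hi2 : Integrable (fun x => σ n (restr n x) * (Q[T n|coordFiltration n]) x) Q :=
      hs2.integrable_mul ((hT2 n).condExp one_le_two)
    have h0 : ∫ x, (max (σ n (restr n x)) 0 * hi n - max (-σ n (restr n x)) 0 * lo n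
        - σ n (restr n x) * (Q[T n|coordFiltration n]) x) ∂Q = 0 := by
      have := hD n hn
      rw [integral_sub hgi hi1] at this
      rw [integral_sub hgi hi2, integral_mul_condExp hsm.stronglyMeasurable hs2 (hT2 n)]
      exact this
    refine (integral_eq_zero_iff_of_nonneg_ae ?_ (hgi.sub hi2)).1 h0
    filter_upwards [hhi n hn, hlo n hn] with x h1 h2
    simp only [Pi.zero_apply, Pi.sub_apply]
    rcases le_total 0 (σ n (restr n x)) with h | h
    · rw [max_eq_left h, max_eq_right (by linarith)]
      nlinarith
    · rw [max_eq_right h, max_eq_left (by linarith)]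
      nlinarith
  have hall := ae_all_iff.2 fun n => ae_all_iff.2 fun hn : d ≤ n =>
    (hhi n hn).and ((hlo n hn).and (hopt n hn))
  filter_upwards [hall, tendsto_average_sub_condExp (Q := Q) hT hTc hsum,
    ae_eventually_notMem hBC] with x hx hxlim hxBC
  -- The drift is the conditional mean of the clipped coordinate; by Borel–Cantelli clipping changes
  -- only finitely many coordinates.
  refine ⟨fun n => (Q[T n|coordFiltration n]) x, ?_, fun n hn => ?_⟩
  · have hr : Tendsto (fun n => x n - T n x) atTop (𝓝 0) := by
      refine tendsto_const_nhds.congr' ?_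
      filter_upwards [hxBC] with n hn
      simp only [not_lt] at hn
      simp [hTdef, clip_eq_self hn]
    have := hr.cesaro.add hxlim
    rw [add_zero] at this
    refine this.congr fun n => ?_
    rw [← div_eq_inv_mul, ← add_div, ← Finset.sum_add_distrib]
    congr 1
    exact Finset.sum_congr rfl fun i _ => by ring
  · obtain ⟨h1, h2, h3⟩ := hx n hn
    refine ⟨⟨h2, h1⟩, fun h => ?_, fun h => ?_⟩
    · rw [max_eq_left h.le, max_eq_right (by linarith)] at h3
      have : σ n (restr n x) * (hi n - (Q[T n|coordFiltration n]) x) = 0 := by linarith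
      rcases mul_eq_zero.1 this with h' | h' <;> linarith
    · rw [max_eq_right h.le, max_eq_left (by linarith)] at h3
      have : σ n (restr n x) * (lo n - (Q[T n|coordFiltration n]) x) = 0 := by linarith
      rcases mul_eq_zero.1 this with h' | h' <;> linarith

end Conditional

/-! ### Cylinder functions -/

/-- `Z` is a bounded Lipschitz function of the first `n` coordinates. -/
def Cyl (n : ℕ) (Z : (ℕ → ℝ) → ℝ) : Prop :=
  ∃ h : (Fin n → ℝ) → ℝ, BddLip h ∧ ∀ x, Z x = h (restr n x)

namespace Cyl

variable {n : ℕ} {Z Z' : (ℕ → ℝ) → ℝ}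

theorem comp_restr {h : (Fin n → ℝ) → ℝ} (hh : BddLip h) : Cyl n fun x => h (restr n x) :=
  ⟨h, hh, fun _ => rfl⟩

theorem continuous (hZ : Cyl n Z) : Continuous Z := by
  obtain ⟨h, hh, hZ⟩ := hZ
  rw [funext hZ]
  exact hh.continuous.comp (continuous_restr n)

theorem measurable (hZ : Cyl n Z) : Measurable Z := hZ.continuous.measurable

theorem exists_bound (hZ : Cyl n Z) : ∃ M, ∀ x, |Z x| ≤ M := by
  obtain ⟨h, ⟨-, M, hM⟩, hZ⟩ := hZ
  exact ⟨M, fun x => by rw [hZ]; exact hM _⟩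

theorem integrable (hZ : Cyl n Z) (Q : Measure (ℕ → ℝ)) [IsProbabilityMeasure Q] :
    Integrable Z Q := by
  obtain ⟨M, hM⟩ := hZ.exists_bound
  exact integrable_of_abs_le hZ.measurable hM

theorem mono (hZ : Cyl n Z) {k : ℕ} (hnk : n ≤ k) : Cyl k Z := by
  obtain ⟨h, hh, hZ⟩ := hZ
  refine ⟨fun y => h fun i => y (Fin.castLE hnk i), hh.comp (K := 1)
    (u := fun (y : Fin k → ℝ) (i : Fin n) => y (Fin.castLE hnk i))
    (LipschitzWith.of_dist_le_mul fun y z => ?_), fun x => hZ x⟩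
  rw [NNReal.coe_one, one_mul]
  exact (dist_pi_le_iff dist_nonneg).2 fun i => dist_le_pi_dist y z _

theorem const (c : ℝ) : Cyl n fun _ => c := ⟨fun _ => c, .const c, fun _ => rfl⟩

theorem add (hZ : Cyl n Z) (hZ' : Cyl n Z') : Cyl n fun x => Z x + Z' x := by
  obtain ⟨h, hh, hZ⟩ := hZ
  obtain ⟨h', hh', hZ'⟩ := hZ'
  exact ⟨_, hh.add hh', fun x => by simp only [hZ, hZ']⟩

theorem sub (hZ : Cyl n Z) (hZ' : Cyl n Z') : Cyl n fun x => Z x - Z' x := by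
  obtain ⟨h, hh, hZ⟩ := hZ
  obtain ⟨h', hh', hZ'⟩ := hZ'
  exact ⟨_, hh.sub hh', fun x => by simp only [hZ, hZ']⟩

theorem mul (hZ : Cyl n Z) (hZ' : Cyl n Z') : Cyl n fun x => Z x * Z' x := by
  obtain ⟨h, hh, hZ⟩ := hZ
  obtain ⟨h', hh', hZ'⟩ := hZ'
  exact ⟨_, hh.mul hh', fun x => by simp only [hZ, hZ']⟩

theorem const_mul (c : ℝ) (hZ : Cyl n Z) : Cyl n fun x => c * Z x := (const c).mul hZ

theorem sum {ι : Type*} (s : Finset ι) {Z : ι → (ℕ → ℝ) → ℝ} (hZ : ∀ i ∈ s, Cyl n (Z i)) :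
    Cyl n fun x => ∑ i ∈ s, Z i x := by
  classical
  induction s using Finset.induction_on with
  | empty => simpa using const (n := n) 0
  | insert a s ha ih =>
    simp only [Finset.sum_insert ha]
    exact (hZ a (Finset.mem_insert_self a s)).add
      (ih fun i hi => hZ i (Finset.mem_insert_of_mem hi))

theorem clip_apply (c : ℝ) {i : ℕ} (hi : i < n) : Cyl n fun x => clip c (x i) :=
  ⟨fun y => clip c (y ⟨i, hi⟩), .clip c (LipschitzWith.eval (⟨i, hi⟩ : Fin n)), fun _ => rfl⟩

end Cyl

/-! ### Families of laws of independent and identically distributed sequences -/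

/-- The upper expectation of a family of measures on sequences. -/
def upE (𝒬 : Set (Measure (ℕ → ℝ))) (Z : (ℕ → ℝ) → ℝ) : ℝ :=
  sSup (Set.image (fun Q : Measure (ℕ → ℝ) => ∫ x, Z x ∂Q) 𝒬)

/-- A family of laws on sequences under whose upper expectation the coordinates are independent
and identically distributed, with compact sets of moments of cylinder functions and uniformly
summable tails. -/
structure IIDFamily (𝒬 : Set (Measure (ℕ → ℝ))) : Prop where
  nonempty : 𝒬.Nonempty
  prob : ∀ Q ∈ 𝒬, IsProbabilityMeasure Q
  compact : ∀ Y : ℕ → (ℕ → ℝ) → ℝ, (∀ j, ∃ n, Cyl n (Y j)) →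
    IsCompact ((fun (Q : Measure (ℕ → ℝ)) (j : ℕ) => ∫ x, Y j x ∂Q) '' 𝒬)
  indep : ∀ (i : ℕ) (φ : (Fin (i + 1) → ℝ) × ℝ → ℝ), BddLip φ →
    upE 𝒬 (fun x => φ (restr (i + 1) x, x (i + 1))) =
      upE 𝒬 (fun x => upE 𝒬 fun y => φ (restr (i + 1) x, y 0))
  tail : ∃ w : ℕ → ℝ, (∀ k, 0 ≤ w k) ∧ Summable w ∧
    ∀ Q ∈ 𝒬, ∀ n k : ℕ, Q {x | (k : ℝ) ≤ |x n|} ≤ ENNReal.ofReal (w k)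

/-- The upper mean of the truncated first coordinate. -/
def upperMean (𝒬 : Set (Measure (ℕ → ℝ))) (c : ℝ) : ℝ := upE 𝒬 fun x => clip c (x 0)

/-- The lower mean of the truncated first coordinate. -/
def lowerMean (𝒬 : Set (Measure (ℕ → ℝ))) (c : ℝ) : ℝ := -upE 𝒬 fun x => -clip c (x 0)

/-- The upper expectation of `s` times the truncated first coordinate. -/
def gain (𝒬 : Set (Measure (ℕ → ℝ))) (c s : ℝ) : ℝ :=
  max s 0 * upperMean 𝒬 c - max (-s) 0 * lowerMean 𝒬 c

/-- The deficit of the `n`-th coordinate with respect to the control `σ n`. -/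
def deficit (𝒬 : Set (Measure (ℕ → ℝ))) (σ : ∀ n, (Fin n → ℝ) → ℝ) (n : ℕ) (x : ℕ → ℝ) : ℝ :=
  gain 𝒬 n (σ n (restr n x)) - σ n (restr n x) * clip n (x n)

namespace IIDFamily

variable {𝒬 : Set (Measure (ℕ → ℝ))}

/-! ### Attained upper expectations and optimal controls -/

/-- Compactness of the moments makes the real supremum in `upE` a maximum, so it is bounded and not
a default value. -/
theorem exists_integral_eq (h𝒬 : IIDFamily 𝒬) {n : ℕ} {Z : (ℕ → ℝ) → ℝ} (hZ : Cyl n Z) :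
    ∃ Q ∈ 𝒬, ∫ x, Z x ∂Q = upE 𝒬 Z ∧ ∀ Q' ∈ 𝒬, ∫ x, Z x ∂Q' ≤ upE 𝒬 Z := by
  have hc := (h𝒬.compact (fun _ => Z) fun _ => ⟨n, hZ⟩).image (continuous_apply 0)
  rw [Set.image_image] at hc
  obtain ⟨Q, hQ, he⟩ := hc.sSup_mem (h𝒬.nonempty.image _)
  exact ⟨Q, hQ, he, fun Q' hQ' => le_csSup hc.bddAbove ⟨Q', hQ', rfl⟩⟩

theorem integral_le_upE (h𝒬 : IIDFamily 𝒬) {n : ℕ} {Z : (ℕ → ℝ) → ℝ} (hZ : Cyl n Z)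
    {Q : Measure (ℕ → ℝ)} (hQ : Q ∈ 𝒬) : ∫ x, Z x ∂Q ≤ upE 𝒬 Z :=
  let ⟨_, _, _, h⟩ := h𝒬.exists_integral_eq hZ
  h Q hQ

theorem compact_of_denumerable (h𝒬 : IIDFamily 𝒬) {ι : Type*} [Denumerable ι] {Y : ι → (ℕ → ℝ) → ℝ}
    (hY : ∀ j, ∃ n, Cyl n (Y j)) :
    IsCompact ((fun (Q : Measure (ℕ → ℝ)) (j : ι) => ∫ x, Y j x ∂Q) '' 𝒬) := by
  have h := (h𝒬.compact (fun k => Y ((Denumerable.eqv ι).symm k)) fun k => hY _).image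
    (f := fun (y : ℕ → ℝ) (j : ι) => y (Denumerable.eqv ι j))
    (continuous_pi fun j => continuous_apply _)
  rw [Set.image_image] at h
  simpa using h

/-- The mean is affine in the mean of the clipped coordinate, whose extreme values are attained; the
sign of `s` decides which one is optimal. -/
theorem upE_add_mul_clip (h𝒬 : IIDFamily 𝒬) (a s c : ℝ) :
    upE 𝒬 (fun x => a + s * clip c (x 0)) = a + gain 𝒬 c s := by
  have hT : Cyl 1 fun x => clip c (x 0) := Cyl.clip_apply c zero_lt_one
  have hT' : Cyl 1 fun x => -clip c (x 0) := by simpa using hT.const_mul (-1)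
  have hint : ∀ Q ∈ 𝒬, ∫ x, (a + s * clip c (x 0)) ∂Q = a + s * ∫ x, clip c (x 0) ∂Q := by
    intro Q hQ
    have := h𝒬.prob Q hQ
    rw [integral_add (integrable_const a) ((hT.integrable Q).const_mul s), integral_const_mul]
    simp
  obtain ⟨Q, hQ, he, hle⟩ := h𝒬.exists_integral_eq ((Cyl.const a).add (hT.const_mul s))
  obtain ⟨Q₁, hQ₁, he₁, hle₁⟩ := h𝒬.exists_integral_eq hT
  obtain ⟨Q₂, hQ₂, he₂, hle₂⟩ := h𝒬.exists_integral_eq hT'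
  have i0 := hint Q hQ
  have i1 := hint Q₁ hQ₁
  have i2 := hint Q₂ hQ₂
  have a1 := hle₁ Q hQ
  have a2 := hle₂ Q hQ
  have b1 := hle Q₁ hQ₁
  have b2 := hle Q₂ hQ₂
  rw [integral_neg] at he₂ a2
  rw [i1, he₁] at b1
  rw [i2] at b2
  rw [← he, i0]
  rw [← he, i0] at b1 b2
  unfold gain upperMean lowerMean
  rcases le_total 0 s with h | h
  · rw [max_eq_left h, max_eq_right (by linarith)]
    have := mul_le_mul_of_nonneg_left a1 h
    linarith
  · rw [max_eq_right h, max_eq_left (by linarith)]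
    have := mul_le_mul_of_nonneg_left a2 (neg_nonneg.2 h)
    have e : ∫ x, clip c (x 0) ∂Q₂ = -upE 𝒬 fun x => -clip c (x 0) := by linarith
    rw [e] at b2
    linarith

theorem lowerMean_le_upperMean (h𝒬 : IIDFamily 𝒬) (c : ℝ) : lowerMean 𝒬 c ≤ upperMean 𝒬 c := by
  obtain ⟨Q, hQ⟩ := h𝒬.nonempty
  have hT : Cyl 1 fun x => clip c (x 0) := Cyl.clip_apply c zero_lt_one
  have h1 := h𝒬.integral_le_upE hT hQ
  have h2 := h𝒬.integral_le_upE (Z := fun x => -clip c (x 0)) (by simpa using hT.const_mul (-1)) hQ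
  rw [integral_neg] at h2
  unfold lowerMean upperMean
  linarith

theorem bddLip_gain {E : Type*} [PseudoMetricSpace E] {s : E → ℝ} (c : ℝ) (hs : BddLip s) :
    BddLip fun x => gain 𝒬 c (s x) := by
  have h1 : BddLip fun x => max (s x) 0 := hs.comp_left (LipschitzWith.id.max_const 0)
  have h2 : BddLip fun x => max (-s x) 0 := hs.neg.comp_left (LipschitzWith.id.max_const 0)
  simpa only [gain, mul_comm _ (upperMean 𝒬 c), mul_comm _ (lowerMean 𝒬 c)] using
    (h1.const_mul (upperMean 𝒬 c)).sub (h2.const_mul (lowerMean 𝒬 c))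

/-- Controlled increments, compensated by their maximal gain, do not change upper expectations. -/
theorem upE_add_control (h𝒬 : IIDFamily 𝒬) {n : ℕ} (hn : 1 ≤ n) (c : ℝ) {W s : (Fin n → ℝ) → ℝ}
    (hW : BddLip W) (hs : BddLip s) :
    upE 𝒬 (fun x => W (restr n x) + (s (restr n x) * clip c (x n) - gain 𝒬 c (s (restr n x)))) =
      upE 𝒬 fun x => W (restr n x) := by
  obtain ⟨i, rfl⟩ : ∃ i, n = i + 1 := ⟨n - 1, by omega⟩
  have hφ : BddLip fun p : (Fin (i + 1) → ℝ) × ℝ =>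
      W p.1 + (s p.1 * clip c p.2 - gain 𝒬 c (s p.1)) :=
    (hW.comp LipschitzWith.prod_fst).add (((hs.comp LipschitzWith.prod_fst).mul
      (BddLip.clip c LipschitzWith.prod_snd)).sub
      (bddLip_gain c (hs.comp LipschitzWith.prod_fst)))
  -- With the past frozen, the best mean of the controlled increment is its gain, so the inner upper
  -- expectation reduces to `W`.
  rw [h𝒬.indep i _ hφ]
  congr 1
  funext x
  have := h𝒬.upE_add_mul_clip
    (W (restr (i + 1) x) - gain 𝒬 c (s (restr (i + 1) x))) (s (restr (i + 1) x)) c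
  simp only [sub_add_cancel] at this
  rw [← this]
  congr 1
  funext y
  ring

theorem cyl_deficit {σ : ∀ n, (Fin n → ℝ) → ℝ} (hσ : ∀ n, BddLip (σ n)) (n : ℕ) :
    Cyl (n + 1) (deficit 𝒬 σ n) :=
  ((Cyl.comp_restr (bddLip_gain n (hσ n))).mono n.le_succ).sub
    (((Cyl.comp_restr (hσ n)).mono n.le_succ).mul (Cyl.clip_apply n n.lt_succ_self))

theorem gain_mul {k : ℝ} (hk : 0 ≤ k) (c s : ℝ) : gain 𝒬 c (k * s) = k * gain 𝒬 c s := by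
  have h1 : max (k * s) 0 = k * max s 0 := by rw [mul_max_of_nonneg _ _ hk, mul_zero]
  have h2 : max (-(k * s)) 0 = k * max (-s) 0 := by
    rw [mul_max_of_nonneg _ _ hk, mul_zero, mul_neg]
  rw [gain, gain, h1, h2]
  ring

theorem integral_mul_clip_le (h𝒬 : IIDFamily 𝒬) {n : ℕ} (hn : 1 ≤ n) (c : ℝ) {s : (Fin n → ℝ) → ℝ}
    (hs : BddLip s) {Q : Measure (ℕ → ℝ)} (hQ : Q ∈ 𝒬) :
    ∫ x, (s (restr n x) * clip c (x n) - gain 𝒬 c (s (restr n x))) ∂Q ≤ 0 := by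
  have h1 := h𝒬.upE_add_control hn c (BddLip.const 0) hs
  have h2 := h𝒬.upE_add_mul_clip 0 0 0
  simp only [gain, zero_mul, neg_zero, max_self, sub_self, add_zero] at h2
  simp only [zero_add] at h1
  rw [h2] at h1
  rw [← h1]
  exact h𝒬.integral_le_upE (((Cyl.comp_restr hs).mono n.le_succ).mul
    (Cyl.clip_apply c n.lt_succ_self) |>.sub
      ((Cyl.comp_restr (bddLip_gain c hs)).mono n.le_succ)) hQ

theorem integral_deficit_nonneg (h𝒬 : IIDFamily 𝒬)
    {σ : ∀ n, (Fin n → ℝ) → ℝ} (hσ : ∀ n, BddLip (σ n)) {n : ℕ}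
    (hn : 1 ≤ n) {Q : Measure (ℕ → ℝ)} (hQ : Q ∈ 𝒬) : 0 ≤ ∫ x, deficit 𝒬 σ n x ∂Q := by
  have h := h𝒬.integral_mul_clip_le hn n (hσ n) hQ
  rw [← neg_nonneg, ← integral_neg] at h
  simpa only [deficit, neg_sub] using h

/-- Deficits are peeled off from the last one backwards. As `gain` is positively homogeneous, `k`
times a deficit is the compensated increment for the control `k * σ`, which `upE_add_control`
removes. -/
theorem upE_sub_deficit (h𝒬 : IIDFamily 𝒬) {d : ℕ} (hd : 1 ≤ d) {Z : (ℕ → ℝ) → ℝ} (hZ : Cyl d Z)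
    {σ : ∀ n, (Fin n → ℝ) → ℝ} (hσ : ∀ n, BddLip (σ n)) {k : ℝ} (hk : 0 ≤ k) (N : ℕ) :
    Cyl (d + N) (fun x => Z x - k * ∑ n ∈ Finset.range N, deficit 𝒬 σ (d + n) x) ∧
    upE 𝒬 (fun x => Z x - k * ∑ n ∈ Finset.range N, deficit 𝒬 σ (d + n) x) = upE 𝒬 Z := by
  have hcyl : ∀ N, Cyl (d + N)
      (fun x => Z x - k * ∑ n ∈ Finset.range N, deficit 𝒬 σ (d + n) x) := fun N =>
    (hZ.mono (Nat.le_add_right _ _)).sub ((Cyl.sum _ fun n hn =>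
      (cyl_deficit hσ (d + n)).mono (by have := Finset.mem_range.1 hn; omega)).const_mul k)
  refine ⟨hcyl N, ?_⟩
  induction N with
  | zero => simp
  | succ N ih =>
    obtain ⟨W, hW, hWeq⟩ := hcyl N
    rw [← ih, funext hWeq]
    rw [← h𝒬.upE_add_control (n := d + N) (by omega) ((d + N : ℕ) : ℝ) hW
      ((hσ (d + N)).const_mul k)]
    congr 1
    funext x
    rw [← hWeq, Finset.sum_range_succ, deficit, gain_mul hk]
    ring

/-- There is a law `Q₀` in the family such that, for all controls, the moments of `Q₀` for a given
sequence of functions of the first `d` coordinates are shared by a law in the family for which the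
controls from time `d` on are exploited optimally. -/
theorem exists_optimal (h𝒬 : IIDFamily 𝒬) {d : ℕ} (hd : 1 ≤ d)
    {f : ℕ → (Fin d → ℝ) → ℝ} (hf : ∀ j, BddLip (f j)) :
    ∃ Q₀ ∈ 𝒬, ∀ σ : ∀ n, (Fin n → ℝ) → ℝ, (∀ n, BddLip (σ n)) →
      ∃ Q ∈ 𝒬, (∀ j, ∫ x, f j (restr d x) ∂Q = ∫ x, f j (restr d x) ∂Q₀) ∧
        ∀ n, d ≤ n → ∫ x, deficit 𝒬 σ n x ∂Q = 0 := by
  have hfc : ∀ j, Cyl d fun x => f j (restr d x) := fun j => Cyl.comp_restr (hf j)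
  obtain ⟨p, ⟨Q₀, hQ₀, hp₀⟩, hp⟩ := exists_lexMax
    (h𝒬.compact (fun j x => f j (restr d x)) fun j => ⟨d, hfc j⟩) (h𝒬.nonempty.image _)
  refine ⟨Q₀, hQ₀, fun σ hσ => ?_⟩
  have hp₀' : ∀ j, p j = ∫ x, f j (restr d x) ∂Q₀ := fun j => (congrFun hp₀ j).symm
  -- The left coordinates record the moments to be retained, the right ones the deficits to be
  -- annihilated.
  let Y : ℕ ⊕ ℕ → (ℕ → ℝ) → ℝ :=
    Sum.elim (fun j x => f j (restr d x)) fun n => deficit 𝒬 σ (d + n)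
  have hY : ∀ j, ∃ n, Cyl n (Y j) := by
    rintro (j | n)
    exacts [⟨d, hfc j⟩, ⟨_, cyl_deficit hσ (d + n)⟩]
  obtain ⟨_, ⟨Q, hQ, rfl⟩, h1, h2⟩ := exists_extension (h𝒬.compact_of_denumerable hY) (p := p)
    (by
      rintro j _ ⟨Q, hQ, rfl⟩ hx
      exact hp j _ ⟨Q, hQ, rfl⟩ hx)
    (by
      rintro _ ⟨Q, hQ, rfl⟩ n
      exact h𝒬.integral_deficit_nonneg hσ (by omega) hQ)
    (by
      intro a N
      have hZ : Cyl d fun x => ∑ i ∈ a.support, a i * f i (restr d x) :=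
        Cyl.sum _ fun i _ => (hfc i).const_mul _
      have hZint : ∀ Q ∈ 𝒬, ∫ x, ∑ i ∈ a.support, a i * f i (restr d x) ∂Q
          = ∑ i ∈ a.support, a i * ∫ x, f i (restr d x) ∂Q := by
        intro Q hQ
        have := h𝒬.prob Q hQ
        rw [integral_finsetSum _ fun i _ => ((hfc i).integrable Q).const_mul _]
        simp only [integral_const_mul]
      obtain ⟨hW, hWe⟩ := h𝒬.upE_sub_deficit hd hZ hσ (Nat.cast_nonneg N) N
      obtain ⟨Q, hQ, he, -⟩ := h𝒬.exists_integral_eq hW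
      refine ⟨_, ⟨Q, hQ, rfl⟩, ?_⟩
      have hprob := h𝒬.prob Q hQ
      have h3 := h𝒬.integral_le_upE hZ hQ₀
      have hdi : ∀ n, Integrable (deficit 𝒬 σ (d + n)) Q := fun n =>
        (cyl_deficit hσ (d + n)).integrable Q
      rw [← hWe, ← he, integral_sub (hZ.integrable Q)
        ((integrable_finsetSum _ fun n _ => hdi n).const_mul _), integral_const_mul,
        integral_finsetSum _ (fun n _ => hdi n), hZint Q hQ, hZint Q₀ hQ₀] at h3
      simpa only [Finsupp.sum, hp₀', Y, Sum.elim_inl, Sum.elim_inr] using h3)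
  refine ⟨Q, hQ, fun j => (h1 j).trans (hp₀' j), fun n hn => ?_⟩
  have := h2 (n - d)
  simpa only [Y, Sum.elim_inr, Nat.add_sub_cancel' hn] using this

/-! ### Consequences of the uniform tails -/

/-- Discrete layer-cake bound, from `n ^ 2` being the sum of the first `n` odd numbers. -/
theorem min_sq_le_sum (a : ℝ) (ha : 0 ≤ a) (n : ℕ) : min a n ^ 2 ≤
    ∑ k ∈ Finset.range n,
      (2 * k + 1) * Set.indicator {y : ℝ | (k : ℝ) ≤ y} (fun _ => (1 : ℝ)) a := by
  induction n with
  | zero => simp [ha]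
  | succ n ih =>
    rw [Finset.sum_range_succ]
    by_cases h : (n : ℝ) ≤ a
    · rw [min_eq_right h] at ih
      rw [Set.indicator_of_mem (show a ∈ {y : ℝ | (n : ℝ) ≤ y} from h)]
      have h1 : min a ((n + 1 : ℕ) : ℝ) ≤ n + 1 := (min_le_right _ _).trans (by simp)
      have h2 : 0 ≤ min a ((n + 1 : ℕ) : ℝ) := le_min ha (Nat.cast_nonneg _)
      nlinarith
    · rw [Set.indicator_of_notMem (show a ∉ {y : ℝ | (n : ℝ) ≤ y} from h), mul_zero, add_zero]
      push Not at h
      rw [min_eq_left (by push_cast; linarith)]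
      rwa [min_eq_left h.le] at ih

theorem abs_clip {c : ℝ} (hc : 0 ≤ c) (x : ℝ) : |clip c x| = min |x| c := by
  rcases le_total |x| c with h | h
  · rw [clip_eq_self h, min_eq_left h]
  · rw [min_eq_right h]
    rcases le_abs.1 h with h' | h'
    · rw [clip, min_eq_right h', max_eq_right (by linarith), abs_of_nonneg hc]
    · rw [clip, min_eq_left (by linarith), max_eq_left (by linarith), abs_neg, abs_of_nonneg hc]

/-- The layer-cake bound reduces the second moments to the tails `w k`. After exchanging the sums,
`∑ 1 / n ^ 2` over `n > k` is at most `2 / (k + 1)`, which cancels the weight `2 * k + 1` up to the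
factor 4. -/
theorem summable_sq (h𝒬 : IIDFamily 𝒬) {Q : Measure (ℕ → ℝ)} (hQ : Q ∈ 𝒬) :
    Summable fun n : ℕ => (∫ x, clip n (x n) ^ 2 ∂Q) / ((n : ℝ) + 1) ^ 2 := by
  obtain ⟨w, hw0, hw, hwQ⟩ := h𝒬.tail
  have := h𝒬.prob Q hQ
  have hmeas : ∀ n k : ℕ, MeasurableSet {x : ℕ → ℝ | (k : ℝ) ≤ |x n|} := fun n k =>
    measurableSet_le measurable_const (measurable_pi_apply n).abs
  have h1 : ∀ n : ℕ, ∫ x, clip n (x n) ^ 2 ∂Q ≤ ∑ k ∈ Finset.range n, (2 * k + 1) * w k := by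
    intro n
    have hi : ∀ k : ℕ, Integrable (fun x : ℕ → ℝ => (2 * (k : ℝ) + 1) *
        Set.indicator {x : ℕ → ℝ | (k : ℝ) ≤ |x n|} (fun _ => (1 : ℝ)) x) Q := fun k =>
      ((integrable_const (1 : ℝ)).indicator (hmeas n k)).const_mul _
    calc ∫ x, clip n (x n) ^ 2 ∂Q
        ≤ ∫ x, ∑ k ∈ Finset.range n, (2 * (k : ℝ) + 1) *
            Set.indicator {x : ℕ → ℝ | (k : ℝ) ≤ |x n|} (fun _ => (1 : ℝ)) x ∂Q := by
          refine integral_mono (memLp_of_abs_le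
            ((continuous_clip n).measurable.comp (measurable_pi_apply n))
            (fun x => abs_clip_le (Nat.cast_nonneg n) _) 2).integrable_sq
            (integrable_finsetSum _ fun k _ => hi k) fun x => ?_
          have := min_sq_le_sum |x n| (abs_nonneg _) n
          rw [← abs_clip (Nat.cast_nonneg n), sq_abs] at this
          exact this
      _ = ∑ k ∈ Finset.range n, (2 * (k : ℝ) + 1) * Q.real {x : ℕ → ℝ | (k : ℝ) ≤ |x n|} := by
          rw [integral_finsetSum _ fun k _ => hi k]
          refine Finset.sum_congr rfl fun k _ => ?_
          rw [integral_const_mul, integral_indicator_const _ (hmeas n k)]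
          simp
      _ ≤ _ := by
          refine Finset.sum_le_sum fun k _ => mul_le_mul_of_nonneg_left ?_ (by positivity)
          exact ENNReal.toReal_le_of_le_ofReal (hw0 k) (hwQ Q hQ n k)
  refine summable_of_sum_range_le (c := 4 * ∑' k, w k) (fun n =>
    div_nonneg (integral_nonneg fun x => sq_nonneg _) (by positivity)) fun N => ?_
  calc ∑ n ∈ Finset.range N, (∫ x, clip n (x n) ^ 2 ∂Q) / ((n : ℝ) + 1) ^ 2
      ≤ ∑ n ∈ Finset.range N, ∑ k ∈ Finset.range n, ((n : ℝ) ^ 2)⁻¹ * ((2 * k + 1) * w k) := by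
        refine Finset.sum_le_sum fun n _ => ?_
        rcases Nat.eq_zero_or_pos n with rfl | hn
        · simpa using h1 0
        · have hn' : (0 : ℝ) < n := by exact_mod_cast hn
          rw [← Finset.mul_sum, div_eq_inv_mul]
          have h0 : 0 ≤ ∫ x, clip n (x n) ^ 2 ∂Q := integral_nonneg fun x => sq_nonneg _
          gcongr
          · linarith
          · exact h1 n
    _ = ∑ k ∈ Finset.range N, ∑ n ∈ Finset.Ioo k N, ((n : ℝ) ^ 2)⁻¹ * ((2 * k + 1) * w k) :=
        Finset.sum_comm' fun n k => by simp only [Finset.mem_range, Finset.mem_Ioo]; omega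
    _ ≤ ∑ k ∈ Finset.range N, 4 * w k := by
        refine Finset.sum_le_sum fun k _ => ?_
        rw [← Finset.sum_mul]
        have h2 := sum_Ioo_inv_sq_le (α := ℝ) k N
        have h3 : 0 ≤ (2 * (k : ℝ) + 1) * w k := mul_nonneg (by positivity) (hw0 k)
        refine (mul_le_mul_of_nonneg_right h2 h3).trans ?_
        rw [div_mul_eq_mul_div, div_le_iff₀ (by positivity)]
        nlinarith [hw0 k, mul_nonneg (Nat.cast_nonneg k : (0 : ℝ) ≤ k) (hw0 k)]
    _ ≤ _ := by
        rw [← Finset.mul_sum]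
        exact mul_le_mul_of_nonneg_left (hw.sum_le_tsum _ fun k _ => hw0 k) (by norm_num)

theorem tsum_tail_ne_top (h𝒬 : IIDFamily 𝒬) {Q : Measure (ℕ → ℝ)} (hQ : Q ∈ 𝒬) :
    ∑' n : ℕ, Q {x | (n : ℝ) < |x n|} ≠ ∞ := by
  obtain ⟨w, hw0, hw, hwQ⟩ := h𝒬.tail
  refine ne_top_of_le_ne_top hw.tsum_ofReal_ne_top (ENNReal.tsum_le_tsum fun n => ?_)
  refine (measure_mono fun x hx => ?_).trans (hwQ Q hQ n n)
  exact le_of_lt (Set.mem_ofPred_eq ▸ hx)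

/-- Both clips fix `[-K, K]` and beyond it differ by at most `|y| - K`, which is bounded by the
number of levels `k + K` not exceeding `|y|`. Integration turns this into a tail of `∑ w k`. -/
theorem ofReal_abs_clip_sub_le {K : ℕ} {c c' : ℝ} (hc : (K : ℝ) ≤ c) (hc' : (K : ℝ) ≤ c') (y : ℝ) :
    ENNReal.ofReal |clip c y - clip c' y| ≤
      ∑' k : ℕ, Set.indicator {y : ℝ | ((k + K : ℕ) : ℝ) ≤ |y|} (fun _ => (1 : ℝ≥0∞)) y := by
  have hK : (0 : ℝ) ≤ K := Nat.cast_nonneg K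
  rcases le_total |y| K with h | h
  · rw [clip_eq_self (h.trans hc), clip_eq_self (h.trans hc')]
    simp
  have h1 : |clip c y - clip c' y| ≤ |y| - K := by
    have key : ∀ c : ℝ, (K : ℝ) ≤ c → (0 ≤ y → K ≤ clip c y ∧ clip c y ≤ y) ∧
        (y ≤ 0 → y ≤ clip c y ∧ clip c y ≤ -K) := by
      intro c hc
      constructor
      · intro hy
        rw [abs_of_nonneg hy] at h
        exact ⟨le_max_of_le_right (le_min h hc), max_le (by linarith) (min_le_left _ _)⟩
      · intro hy
        rw [abs_of_nonpos hy] at h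
        exact ⟨le_max_of_le_right (le_min le_rfl (by linarith)),
          max_le (by linarith) ((min_le_left _ _).trans (by linarith))⟩
    rcases le_total 0 y with hy | hy
    · have a := (key c hc).1 hy
      have b := (key c' hc').1 hy
      rw [abs_of_nonneg hy, abs_le]
      constructor <;> linarith
    · have a := (key c hc).2 hy
      have b := (key c' hc').2 hy
      rw [abs_of_nonpos hy, abs_le]
      constructor <;> linarith
  set N := ⌈|y| - K⌉₊
  calc ENNReal.ofReal |clip c y - clip c' y| ≤ ENNReal.ofReal (N : ℝ) :=
        ENNReal.ofReal_le_ofReal (h1.trans (Nat.le_ceil _))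
    _ = ∑ k ∈ Finset.range N, (1 : ℝ≥0∞) := by simp
    _ ≤ ∑ k ∈ Finset.range N,
          Set.indicator {y : ℝ | ((k + K : ℕ) : ℝ) ≤ |y|} (fun _ => (1 : ℝ≥0∞)) y := by
        refine Finset.sum_le_sum fun k hk => ?_
        have := Nat.lt_ceil.1 (Finset.mem_range.1 hk)
        rw [Set.indicator_of_mem]
        simp only [Set.mem_ofPred_eq]
        push_cast
        linarith
    _ ≤ _ := ENNReal.sum_le_tsum _

/-- The truncated means of a multiple of the first coordinate converge. -/
theorem exists_tendsto_upE (h𝒬 : IIDFamily 𝒬) (s : ℝ) (hs : |s| = 1) :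
    ∃ m, Tendsto (fun c : ℝ => upE 𝒬 fun x => s * clip c (x 0)) atTop (𝓝 m) := by
  obtain ⟨w, hw0, hw, hwQ⟩ := h𝒬.tail
  have hcyl : ∀ c, Cyl 1 fun x => s * clip c (x 0) := fun c =>
    (Cyl.clip_apply c zero_lt_one).const_mul s
  have htail : ∀ K : ℕ, Summable fun k => w (k + K) := fun K => (summable_nat_add_iff K).2 hw
  have hdiff : ∀ (K : ℕ) (c c' : ℝ), (K : ℝ) ≤ c → (K : ℝ) ≤ c' → ∀ Q ∈ 𝒬,
      ∫ x, s * clip c (x 0) ∂Q - ∫ x, s * clip c' (x 0) ∂Q ≤ ∑' k, w (k + K) := by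
    intro K c c' hc hc' Q hQ
    have := h𝒬.prob Q hQ
    have hi := fun c => (hcyl c).integrable Q
    rw [← integral_sub (hi c) (hi c')]
    refine (le_abs_self _).trans (abs_integral_le_integral_abs.trans ?_)
    have h1 : ∀ x : ℕ → ℝ, |s * clip c (x 0) - s * clip c' (x 0)|
        = |clip c (x 0) - clip c' (x 0)| := fun x => by rw [← mul_sub, abs_mul, hs, one_mul]
    simp only [h1]
    have hmeas : ∀ k : ℕ, MeasurableSet {y : ℝ | ((k + K : ℕ) : ℝ) ≤ |y|} := fun k =>
      measurableSet_le measurable_const measurable_id.abs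
    rw [integral_eq_lintegral_of_nonneg_ae (Eventually.of_forall fun x => abs_nonneg _)
      (Continuous.aestronglyMeasurable (by
        have := continuous_clip c
        have := continuous_clip c'
        fun_prop))]
    refine ENNReal.toReal_le_of_le_ofReal (tsum_nonneg fun k => hw0 _) ?_
    calc ∫⁻ x, ENNReal.ofReal |clip c (x 0) - clip c' (x 0)| ∂Q
        ≤ ∫⁻ x, ∑' k : ℕ, Set.indicator {y : ℝ | ((k + K : ℕ) : ℝ) ≤ |y|}
            (fun _ => (1 : ℝ≥0∞)) (x 0) ∂Q :=
          lintegral_mono fun x => ofReal_abs_clip_sub_le hc hc' (x 0)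
      _ = ∑' k : ℕ, Q {x | ((k + K : ℕ) : ℝ) ≤ |x 0|} := by
          have hm : ∀ k : ℕ, Measurable fun x : ℕ → ℝ =>
              Set.indicator {y : ℝ | ((k + K : ℕ) : ℝ) ≤ |y|} (fun _ => (1 : ℝ≥0∞)) (x 0) :=
            fun k => (measurable_const.indicator (hmeas k)).comp (measurable_pi_apply 0)
          rw [lintegral_tsum fun k => (hm k).aemeasurable]
          congr 1
          funext k
          exact lintegral_indicator_one (measurable_pi_apply (X := fun _ : ℕ => ℝ) 0 (hmeas k))
      _ ≤ ∑' k, ENNReal.ofReal (w (k + K)) := ENNReal.tsum_le_tsum fun k => hwQ Q hQ 0 _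
      _ = ENNReal.ofReal (∑' k, w (k + K)) :=
          (ENNReal.ofReal_tsum_of_nonneg (fun k => hw0 _) (htail K)).symm
  have hup : ∀ (K : ℕ) (c c' : ℝ), (K : ℝ) ≤ c → (K : ℝ) ≤ c' →
      upE 𝒬 (fun x => s * clip c (x 0)) - upE 𝒬 (fun x => s * clip c' (x 0))
        ≤ ∑' k, w (k + K) := by
    intro K c c' hc hc'
    obtain ⟨Q, hQ, he, -⟩ := h𝒬.exists_integral_eq (hcyl c)
    have := h𝒬.integral_le_upE (hcyl c') hQ
    have := hdiff K c c' hc hc' Q hQ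
    linarith
  refine cauchySeq_tendsto_of_complete (Metric.cauchySeq_iff'.2 fun ε hε => ?_)
  obtain ⟨K, hK⟩ := ((tendsto_sum_nat_add w).eventually_lt_const hε).exists
  refine ⟨K, fun c hc => ?_⟩
  rw [Real.dist_eq, abs_lt]
  have a := hup K c K hc le_rfl
  have b := hup K K c le_rfl hc
  constructor <;> linarith

end IIDFamily

/-! ### A countable family of bounded Lipschitz functions determining measures -/

/-- Sines and cosines of linear forms with rational coefficients suffice: they are bounded
Lipschitz, and by continuity in the frequency they determine the characteristic function. -/
theorem exists_determining (d : ℕ) :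
    ∃ f : ℕ → (Fin d → ℝ) → ℝ, (∀ j, BddLip (f j)) ∧
      ∀ μ ν : Measure (Fin d → ℝ), IsProbabilityMeasure μ → IsProbabilityMeasure ν →
        (∀ j, ∫ y, f j y ∂μ = ∫ y, f j y ∂ν) → μ = ν := by
  let ℓ : (Fin d → ℝ) → (Fin d → ℝ) →L[ℝ] ℝ := fun t =>
    ∑ i, t i • ContinuousLinearMap.proj (R := ℝ) (φ := fun _ : Fin d => ℝ) i
  have hℓ : ∀ t y, ℓ t y = ∑ i, t i * y i := fun t y => by
    simp [ℓ]
  have hℓc : Continuous fun p : (Fin d → ℝ) × (Fin d → ℝ) => ℓ p.1 p.2 := by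
    simp only [hℓ]
    fun_prop
  let g : ((Fin d → ℚ) × Bool) → (Fin d → ℝ) → ℝ := fun q y =>
    bif q.2 then Real.cos (ℓ (fun i => q.1 i) y) else Real.sin (ℓ (fun i => q.1 i) y)
  obtain ⟨e, he⟩ := exists_surjective_nat ((Fin d → ℚ) × Bool)
  refine ⟨fun j => g (e j), fun j => ?_, fun μ ν hμ hν h => ?_⟩
  · change BddLip (g (e j))
    rcases e j with ⟨q, b⟩
    cases b
    · exact ⟨⟨_, Real.lipschitzWith_sin.comp (ℓ fun i => q i).lipschitz⟩, 1,
        fun x => Real.abs_sin_le_one _⟩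
    · exact ⟨⟨_, Real.lipschitzWith_cos.comp (ℓ fun i => q i).lipschitz⟩, 1,
        fun x => Real.abs_cos_le_one _⟩
  · have hcont : ∀ (μ : Measure (Fin d → ℝ)), IsProbabilityMeasure μ →
        Continuous (fun t => ∫ y, Real.cos (ℓ t y) ∂μ) ∧
        Continuous (fun t => ∫ y, Real.sin (ℓ t y) ∂μ) := by
      intro μ hμ
      have hy : ∀ t, Continuous fun y => ℓ t y := fun t => (ℓ t).continuous
      have ht : ∀ y, Continuous fun t => ℓ t y := fun y =>
        hℓc.comp (continuous_id.prodMk continuous_const)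
      constructor
      · exact continuous_of_dominated (bound := fun _ => 1)
          (fun t => (Real.continuous_cos.comp (hy t)).aestronglyMeasurable)
          (fun t => Eventually.of_forall fun y => Real.abs_cos_le_one _) (integrable_const 1)
          (Eventually.of_forall fun y => Real.continuous_cos.comp (ht y))
      · exact continuous_of_dominated (bound := fun _ => 1)
          (fun t => (Real.continuous_sin.comp (hy t)).aestronglyMeasurable)
          (fun t => Eventually.of_forall fun y => Real.abs_sin_le_one _) (integrable_const 1)
          (Eventually.of_forall fun y => Real.continuous_sin.comp (ht y))
    have hdense : DenseRange fun (q : Fin d → ℚ) (i : Fin d) => (q i : ℝ) :=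
      DenseRange.piMap (f := fun (_ : Fin d) (r : ℚ) => (r : ℝ)) fun _ => Rat.denseRange_cast
    have hcos : (fun t => ∫ y, Real.cos (ℓ t y) ∂μ) = fun t => ∫ y, Real.cos (ℓ t y) ∂ν := by
      refine hdense.equalizer (hcont μ hμ).1 (hcont ν hν).1 (funext fun q => ?_)
      obtain ⟨j, hj⟩ := he (q, true)
      simpa [g, hj] using h j
    have hsin : (fun t => ∫ y, Real.sin (ℓ t y) ∂μ) = fun t => ∫ y, Real.sin (ℓ t y) ∂ν := by
      refine hdense.equalizer (hcont μ hμ).2 (hcont ν hν).2 (funext fun q => ?_)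
      obtain ⟨j, hj⟩ := he (q, false)
      simpa [g, hj] using h j
    refine Measure.ext_of_charFunDual (funext fun L => ?_)
    have hL : ∀ y, L y = ℓ (fun i => L (Pi.single i 1)) y := by
      intro y
      rw [hℓ]
      conv_lhs => rw [← Finset.univ_sum_single y]
      rw [map_sum]
      refine Finset.sum_congr rfl fun i _ => ?_
      rw [show Pi.single i (y i) = y i • (Pi.single i 1 : Fin d → ℝ) by
        rw [← Pi.single_smul', smul_eq_mul, mul_one], map_smul, smul_eq_mul, mul_comm]
    set t : Fin d → ℝ := fun i => L (Pi.single i 1)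
    have key : ∀ (μ : Measure (Fin d → ℝ)), IsProbabilityMeasure μ → charFunDual μ L =
        ((∫ y, Real.cos (ℓ t y) ∂μ : ℝ) : ℂ) + ((∫ y, Real.sin (ℓ t y) ∂μ : ℝ) : ℂ) * Complex.I := by
      intro μ hμ
      have i1 : Integrable (fun y => Real.cos (ℓ t y)) μ :=
        Integrable.of_bound (Real.continuous_cos.comp (ℓ t).continuous).aestronglyMeasurable 1
          (Eventually.of_forall fun y => Real.abs_cos_le_one _)
      have i2 : Integrable (fun y => Real.sin (ℓ t y)) μ :=
        Integrable.of_bound (Real.continuous_sin.comp (ℓ t).continuous).aestronglyMeasurable 1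
          (Eventually.of_forall fun y => Real.abs_sin_le_one _)
      rw [charFunDual_apply, ← integral_complex_ofReal, ← integral_complex_ofReal,
        ← integral_mul_const, ← integral_add i1.ofReal (i2.ofReal.mul_const _)]
      refine integral_congr_ae (Eventually.of_forall fun y => ?_)
      simp only [hL, Complex.exp_mul_I, Complex.ofReal_cos, Complex.ofReal_sin]
    rw [key μ hμ, key ν hν, congrFun hcos t, congrFun hsin t]

/-! ### Steering towards a target -/

/-- The control which compares the running average with the target `τ`. -/
def steer (τ : ∀ n, (Fin n → ℝ) → ℝ) (n : ℕ) (y : Fin n → ℝ) : ℝ :=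
  clip 1 (τ n y - (∑ i, y i) / n)

/-- The drift depends only on the sign of the control. Clipping preserves it and supplies the
boundedness that the average lacks. -/
theorem bddLip_steer {τ : ∀ n, (Fin n → ℝ) → ℝ} (hτ : ∀ n, BddLip (τ n)) (n : ℕ) :
    BddLip (steer τ n) := by
  obtain ⟨⟨K, hK⟩, -⟩ := hτ n
  have h1 := ((n : ℝ)⁻¹ • ∑ i, ContinuousLinearMap.proj (R := ℝ)
    (φ := fun _ : Fin n => ℝ) i).lipschitz
  have h2 : ∀ y : Fin n → ℝ, ((n : ℝ)⁻¹ • ∑ i, ContinuousLinearMap.proj (R := ℝ)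
      (φ := fun _ : Fin n => ℝ) i) y = (∑ i, y i) / n := fun y => by simp [div_eq_inv_mul]
  have h3 := hK.sub h1
  simp only [h2] at h3
  exact BddLip.clip 1 h3

theorem clip_one_pos {z : ℝ} (hz : 0 < z) : 0 < clip 1 z :=
  lt_max_of_lt_right (lt_min hz one_pos)

theorem clip_one_neg {z : ℝ} (hz : z < 0) : clip 1 z < 0 :=
  max_lt (by norm_num) ((min_le_left _ _).trans_lt hz)

namespace IIDFamily

variable {𝒬 : Set (Measure (ℕ → ℝ))}

/-- Vanishing deficits of the feedback control push the drift to its upper extreme below the target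
and to its lower extreme above it. The exceptional null set does not depend on the limit `t`. -/
theorem ae_tendsto_average (h𝒬 : IIDFamily 𝒬) {d : ℕ} (hd : 1 ≤ d) {L H : ℝ}
    (hlo : Tendsto (fun n : ℕ => lowerMean 𝒬 n) atTop (𝓝 L))
    (hhi : Tendsto (fun n : ℕ => upperMean 𝒬 n) atTop (𝓝 H))
    {τ : ∀ n, (Fin n → ℝ) → ℝ} (hτ : ∀ n, BddLip (τ n)) {Q : Measure (ℕ → ℝ)} (hQ : Q ∈ 𝒬)
    (hD : ∀ n, d ≤ n → ∫ x, deficit 𝒬 (steer τ) n x ∂Q = 0) :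
    ∀ᵐ x ∂Q, ∀ t, L ≤ t → t ≤ H → Tendsto (fun n => τ n (restr n x)) atTop (𝓝 t) →
      Tendsto (fun n : ℕ => (∑ i ∈ Finset.range n, x i) / (n : ℝ)) atTop (𝓝 t) := by
  have := h𝒬.prob Q hQ
  have hup : ∀ n, d ≤ n → ∀ g : (Fin n → ℝ) → ℝ, BddLip g → (∀ y, 0 ≤ g y) →
      ∫ x, g (restr n x) * (clip n (x n) - upperMean 𝒬 n) ∂Q ≤ 0 := by
    intro n hn g hg hg0
    have h := h𝒬.integral_mul_clip_le (hd.trans hn) n hg hQ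
    refine le_of_eq_of_le (integral_congr_ae (Eventually.of_forall fun x => ?_)) h
    have := hg0 (restr n x)
    simp only [gain, max_eq_left this, max_eq_right (neg_nonpos.2 this)]
    ring
  have hlow : ∀ n, d ≤ n → ∀ g : (Fin n → ℝ) → ℝ, BddLip g → (∀ y, 0 ≤ g y) →
      ∫ x, g (restr n x) * (lowerMean 𝒬 n - clip n (x n)) ∂Q ≤ 0 := by
    intro n hn g hg hg0
    have h := h𝒬.integral_mul_clip_le (hd.trans hn) n hg.neg hQ
    refine le_of_eq_of_le (integral_congr_ae (Eventually.of_forall fun x => ?_)) h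
    have := hg0 (restr n x)
    simp only [gain, neg_neg, max_eq_left this, max_eq_right (neg_nonpos.2 this)]
    ring
  filter_upwards [ae_exists_drift (Q := Q) hup hlow (bddLip_steer hτ) hD (h𝒬.summable_sq hQ)
    (h𝒬.tsum_tail_ne_top hQ)] with x ⟨m, hm, hdrift⟩ t hLt htH hxt
  have hsum : ∀ n, ∑ i, restr n x i = ∑ i ∈ Finset.range n, x i := fun n =>
    Fin.sum_univ_eq_sum_range x n
  refine tendsto_average_of_control hm hlo hhi hLt htH hxt (fun n hn => (hdrift n hn).1)
    (fun n hn h => (hdrift n hn).2.1 (clip_one_pos ?_))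
    (fun n hn h => (hdrift n hn).2.2 (clip_one_neg ?_))
  · rw [hsum]; linarith
  · rw [hsum]; linarith

/-- Every Borel function of finitely many coordinates, clamped to the interval of means, is the
limit of the averages under some law of the family. -/
theorem exists_tendsto_of_measurable (h𝒬 : IIDFamily 𝒬) {L H : ℝ} (hLH : L ≤ H)
    (hlo : Tendsto (fun n : ℕ => lowerMean 𝒬 n) atTop (𝓝 L))
    (hhi : Tendsto (fun n : ℕ => upperMean 𝒬 n) atTop (𝓝 H))
    {d : ℕ} (hd : 1 ≤ d) {φ : (Fin d → ℝ) → ℝ} (hφ : Measurable φ) :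
    ∃ Q ∈ 𝒬, ∀ᵐ x ∂Q, Tendsto (fun n : ℕ => (∑ i ∈ Finset.range n, x i) / (n : ℝ)) atTop
      (𝓝 (max L (min (φ (restr d x)) H))) := by
  obtain ⟨f, hf, hdet⟩ := exists_determining d
  -- `Q₀` is fixed before the targets are chosen: they approximate `φ` almost surely under its law,
  -- which the later optimal law shares.
  obtain ⟨Q₀, hQ₀, hopt⟩ := h𝒬.exists_optimal hd hf
  have := h𝒬.prob Q₀ hQ₀
  have hprob : IsProbabilityMeasure (Q₀.map (restr d)) :=
    Measure.isProbabilityMeasure_map (measurable_restr d).aemeasurable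
  have hcl : ∀ z : ℝ, L ≤ max L (min z H) ∧ max L (min z H) ≤ H := fun z =>
    ⟨le_max_left _ _, max_le hLH (min_le_right _ _)⟩
  obtain ⟨g, hg, -, hgt⟩ := exists_bddLip_tendsto_ae (Q₀.map (restr d))
    (φ := fun y => max L (min (φ y) H)) (measurable_const.max (hφ.min measurable_const))
    fun y => hcl (φ y)
  -- The value 0 before time `d` is immaterial, since control starts at `d`.
  let τ : ∀ n, (Fin n → ℝ) → ℝ := fun n y =>
    if h : d ≤ n then g n fun i => y (Fin.castLE h i) else 0
  have hτ : ∀ n, BddLip (τ n) := by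
    intro n
    by_cases h : d ≤ n
    · simp only [τ, h, dite_true]
      refine (hg n).comp (K := 1) (u := fun (y : Fin n → ℝ) (i : Fin d) => y (Fin.castLE h i))
        (LipschitzWith.of_dist_le_mul fun y z => ?_)
      rw [NNReal.coe_one, one_mul]
      exact (dist_pi_le_iff dist_nonneg).2 fun i => dist_le_pi_dist y z _
    · simp only [τ, h, dite_false]
      exact BddLip.const 0
  obtain ⟨Q, hQ, hmom, hD⟩ := hopt (steer τ) (bddLip_steer hτ)
  have := h𝒬.prob Q hQ
  have hlaw : Q.map (restr d) = Q₀.map (restr d) := by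
    refine hdet _ _ (Measure.isProbabilityMeasure_map (measurable_restr d).aemeasurable) hprob
      fun j => ?_
    rw [integral_map (measurable_restr d).aemeasurable (hf j).continuous.aestronglyMeasurable,
      integral_map (measurable_restr d).aemeasurable (hf j).continuous.aestronglyMeasurable]
    exact hmom j
  rw [← hlaw] at hgt
  refine ⟨Q, hQ, ?_⟩
  filter_upwards [h𝒬.ae_tendsto_average hd hlo hhi hτ hQ hD,
    ae_of_ae_map (measurable_restr d).aemeasurable hgt] with x hx hxg
  refine hx _ (hcl _).1 (hcl _).2 (hxg.congr' ?_)
  filter_upwards [eventually_ge_atTop d] with n hn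
  simp only [τ, hn, dite_true]
  rfl

/-- Every function which is the quasi-sure limit of cylinder functions, clamped to the interval of
means, is the limit of the averages under some law of the family. -/
theorem exists_tendsto_of_approx (h𝒬 : IIDFamily 𝒬) {L H : ℝ} (hLH : L ≤ H)
    (hlo : Tendsto (fun n : ℕ => lowerMean 𝒬 n) atTop (𝓝 L))
    (hhi : Tendsto (fun n : ℕ => upperMean 𝒬 n) atTop (𝓝 H))
    {φ : (ℕ → ℝ) → ℝ} {τ : ∀ n, (Fin n → ℝ) → ℝ} (hτ : ∀ n, BddLip (τ n))
    (hφ : ∀ Q ∈ 𝒬, ∀ᵐ x ∂Q, Tendsto (fun n => τ n (restr n x)) atTop (𝓝 (φ x))) :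
    ∃ Q ∈ 𝒬, ∀ᵐ x ∂Q, Tendsto (fun n : ℕ => (∑ i ∈ Finset.range n, x i) / (n : ℝ)) atTop
      (𝓝 (max L (min (φ x) H))) := by
  have hτ' : ∀ n, BddLip fun y => max L (min (τ n y) H) := fun n =>
    BddLip.clamp L H (hτ n).1.choose_spec
  -- No law needs to be retained here, so the prescribed moments are trivial.
  obtain ⟨Q₀, -, hopt⟩ := h𝒬.exists_optimal le_rfl (f := fun _ _ => 0) fun _ => BddLip.const 0
  obtain ⟨Q, hQ, -, hD⟩ := hopt _ (bddLip_steer hτ')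
  refine ⟨Q, hQ, ?_⟩
  filter_upwards [h𝒬.ae_tendsto_average le_rfl hlo hhi hτ' hQ hD, hφ Q hQ] with x hx hxφ
  exact hx _ (le_max_left _ _) (max_le hLH (min_le_right _ _))
    (((lipschitzWith_clamp L H).continuous.tendsto _).comp hxφ)

end IIDFamily

/-! ### Approximation by functions of finitely many coordinates -/

section SeqMetric

/-- The metric `∑ min (2⁻ⁱ) |xᵢ - yᵢ|` on sequences. -/
@[reducible] def seqMetric : PseudoMetricSpace (ℕ → ℝ) := PiCountable.pseudoMetricSpace

attribute [local instance] seqMetric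

theorem seq_dist_eq (x y : ℕ → ℝ) :
    dist x y = ∑' i : ℕ, min ((2 : ℝ)⁻¹ ^ i) (dist (x i) (y i)) := rfl

theorem seq_dist_summable (x y : ℕ → ℝ) :
    Summable fun i : ℕ => min ((2 : ℝ)⁻¹ ^ i) (dist (x i) (y i)) :=
  PiCountable.dist_summable x y

/-- Extension of a finite sequence by zeros. -/
def pad (n : ℕ) (y : Fin n → ℝ) : ℕ → ℝ := fun i => if h : i < n then y ⟨i, h⟩ else 0

/-- Only coordinates from `n` on are altered, and their metric weights sum to `2 * 2⁻¹ ^ n`. -/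
theorem dist_pad_restr_le (n : ℕ) (x : ℕ → ℝ) :
    dist x (pad n (restr n x)) ≤ 2 * (2 : ℝ)⁻¹ ^ n := by
  have hs := seq_dist_summable x (pad n (restr n x))
  rw [seq_dist_eq, ← hs.sum_add_tsum_nat_add n]
  have h0 : ∑ i ∈ Finset.range n,
      min ((2 : ℝ)⁻¹ ^ i) (dist (x i) (pad n (restr n x) i)) = 0 := by
    refine Finset.sum_eq_zero fun i hi => ?_
    simp [pad, restr, Finset.mem_range.1 hi]
  rw [h0, zero_add]
  have hg : Summable fun i : ℕ => (2 : ℝ)⁻¹ ^ i := summable_geometric_of_lt_one (by norm_num)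
    (by norm_num)
  calc ∑' i : ℕ, min ((2 : ℝ)⁻¹ ^ (i + n)) (dist (x (i + n)) (pad n (restr n x) (i + n)))
      ≤ ∑' i : ℕ, (2 : ℝ)⁻¹ ^ i * (2 : ℝ)⁻¹ ^ n := by
        refine ((summable_nat_add_iff n).2 hs).tsum_le_tsum (fun i => ?_) (hg.mul_right _)
        rw [← pow_add]
        exact min_le_left _ _
    _ = 2 * (2 : ℝ)⁻¹ ^ n := by
        rw [tsum_mul_right, tsum_geometric_of_lt_one (by norm_num) (by norm_num)]
        norm_num

theorem dist_pad_le (n : ℕ) (y z : Fin n → ℝ) : dist (pad n y) (pad n z) ≤ n * dist y z := by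
  rw [seq_dist_eq, tsum_eq_sum (s := Finset.range n)]
  · calc ∑ i ∈ Finset.range n, min ((2 : ℝ)⁻¹ ^ i) (dist (pad n y i) (pad n z i))
        ≤ ∑ i ∈ Finset.range n, dist y z := by
          refine Finset.sum_le_sum fun i hi => (min_le_right _ _).trans ?_
          simp only [pad, Finset.mem_range.1 hi, dite_true]
          exact dist_le_pi_dist y z _
      _ = n * dist y z := by simp
  · intro i hi
    have : ¬ i < n := by simpa using hi
    simp [pad, this]

theorem bddLip_comp_pad {g : (ℕ → ℝ) → ℝ} (hg : BddLip g) (n : ℕ) :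
    BddLip fun y : Fin n → ℝ => g (pad n y) :=
  hg.comp (K := n) (LipschitzWith.of_dist_le_mul fun y z => by simpa using dist_pad_le n y z)

theorem tendsto_mul_geometric :
    Tendsto (fun n : ℕ => 2 * ((n : ℝ) * (2 : ℝ)⁻¹ ^ n)) atTop (𝓝 0) := by
  simpa using (tendsto_self_mul_const_pow_of_lt_one (r := (2 : ℝ)⁻¹) (by norm_num)
    (by norm_num)).const_mul 2

/-- Bounded continuous functions are approximated by Lipschitz functions uniformly over the
family. -/
theorem IIDFamily.exists_lipschitz_approx {𝒬 : Set (Measure (ℕ → ℝ))} (h𝒬 : IIDFamily 𝒬)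
    (f : (ℕ → ℝ) →ᵇ ℝ) {ε : ℝ} (hε : 0 < ε) :
    ∃ (K : ℕ) (g : (ℕ → ℝ) → ℝ), (∀ x y, |g x - g y| ≤ K * dist x y) ∧ BddLip g ∧
      ∀ Q ∈ 𝒬, ∫⁻ x, ENNReal.ofReal |f x - g x| ∂Q ≤ ENNReal.ofReal ε := by
  have hfM : ∀ x, |f x| ≤ ‖f‖ := fun x => f.norm_coe_le_norm x
  have hfM' : ∀ x, |-f x| ≤ ‖f‖ := fun x => by rw [abs_neg]; exact hfM x
  let l : ℕ → (ℕ → ℝ) → ℝ := fun j => lipLower f j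
  let r : ℕ → (ℕ → ℝ) → ℝ := fun j => lipLower (fun x => -f x) j
  let u : ℕ → (ℕ → ℝ) → ℝ := fun j x => -r j x - l j x
  have hlf : ∀ j x, l j x ≤ f x := fun j x => lipLower_le hfM j x
  have hrf : ∀ j x, r j x ≤ -f x := fun j x => lipLower_le hfM' j x
  have hl : ∀ j, BddLip (l j) := fun j => bddLip_lipLower hfM j
  have hr : ∀ j, BddLip (r j) := fun j => bddLip_lipLower hfM' j
  have hu : ∀ j, BddLip (u j) := fun j => (hr j).neg.sub (hl j)
  have huM : ∀ j x, |u j x| ≤ 2 * ‖f‖ := fun j x => by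
    have h1 := abs_lipLower_le hfM j x
    have h2 := abs_lipLower_le hfM' j x
    refine (abs_sub _ _).trans ?_
    rw [abs_neg]
    change |lipLower (fun x => -f x) j x| + |lipLower f j x| ≤ _
    linarith
  have hu0 : ∀ j x, 0 ≤ u j x := fun j x => by
    have := hlf j x
    have := hrf j x
    simp only [u]
    linarith
  have huanti : ∀ {i j : ℕ}, i ≤ j → ∀ x, u j x ≤ u i x := fun {i j} hij x => by
    have h1 : l i x ≤ l j x := lipLower_mono hfM hij x
    have h2 : r i x ≤ r j x := lipLower_mono hfM' hij x
    simp only [u]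
    linarith
  have hulim : ∀ x, Tendsto (fun j => u j x) atTop (𝓝 0) := fun x => by
    have h1 := tendsto_lipLower hfM f.continuous x
    have h2 := tendsto_lipLower hfM' f.continuous.neg x
    simpa using h2.neg.sub h1
  have hui : ∀ Q ∈ 𝒬, ∀ j, Integrable (u j) Q := fun Q hQ j => by
    have := h𝒬.prob Q hQ
    exact integrable_of_abs_le (hu j).continuous.measurable (huM j)
  -- A Dini argument over the family: the gap `u j` between the Lipschitz envelopes decreases to 0.
  -- If its means stayed above `ε`, compactness would give one law contradicting dominated
  -- convergence.
  have key : ∃ j, ∀ Q ∈ 𝒬, ∫ x, u j x ∂Q ≤ ε := by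
    by_contra! hcon
    choose P hP hPε using hcon
    let Y : ℕ → (ℕ → ℝ) → ℝ := fun j x => u j (pad j (restr j x))
    -- Compactness concerns cylinder functions, so `u j` is evaluated at the padded sequence. Both
    -- envelopes are `j`-Lipschitz and the padding distance is at most `2 * 2⁻¹ ^ j`.
    let e : ℕ → ℝ := fun j => 2 * (2 * (j * (2 : ℝ)⁻¹ ^ j))
    have hY : ∀ j, Cyl j (Y j) := fun j => Cyl.comp_restr (bddLip_comp_pad (hu j) j)
    have hYu : ∀ j x, |Y j x - u j x| ≤ e j := fun j x => by
      have h1 := lipLower_sub_le hfM j x (pad j (restr j x))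
      have h2 := lipLower_sub_le hfM' j x (pad j (restr j x))
      have h3 : (j : ℝ) * dist x (pad j (restr j x)) ≤ j * (2 * (2 : ℝ)⁻¹ ^ j) := by
        gcongr
        exact dist_pad_restr_le j x
      rw [abs_le] at h1 h2 ⊢
      simp only [Y, u, l, r, e]
      constructor <;> linarith [h1.1, h1.2, h2.1, h2.2]
    have hYint : ∀ Q ∈ 𝒬, ∀ j, |∫ x, Y j x ∂Q - ∫ x, u j x ∂Q| ≤ e j := fun Q hQ j => by
      have := h𝒬.prob Q hQ
      rw [← integral_sub ((hY j).integrable Q) (hui Q hQ j)]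
      have := norm_integral_le_of_norm_le_const (μ := Q) (f := fun x => Y j x - u j x)
        (Eventually.of_forall fun x => hYu j x)
      simpa using this
    have hC := h𝒬.compact Y fun j => ⟨j, hY j⟩
    set C := (fun (Q : Measure (ℕ → ℝ)) (j : ℕ) => ∫ x, Y j x ∂Q) '' 𝒬 with hCdef
    have hcl : ∀ i : ℕ, IsCompact (C ∩ ⋂ j, ⋂ (_ : j ≤ i), {y : ℕ → ℝ | ε - e j ≤ y j}) :=
      fun i => hC.inter_right (isClosed_iInter fun j => isClosed_iInter fun _ =>
        isClosed_le continuous_const (continuous_apply j))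
    obtain ⟨y, hy⟩ := IsCompact.nonempty_iInter_of_sequence_nonempty_isCompact_isClosed
      (fun i : ℕ => C ∩ ⋂ j, ⋂ (_ : j ≤ i), {y : ℕ → ℝ | ε - e j ≤ y j})
      (fun i => Set.inter_subset_inter_right C (Set.iInter_mono fun j => fun z hz => by
        simp only [Set.mem_iInter] at hz ⊢
        exact fun hj => hz (hj.trans i.le_succ)))
      (fun i => by
        refine ⟨_, ⟨P i, hP i, rfl⟩, ?_⟩
        simp only [Set.mem_iInter]
        intro j hj
        have h1 := (abs_le.1 (hYint (P i) (hP i) j)).1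
        have h2 : ∫ x, u i x ∂P i ≤ ∫ x, u j x ∂P i :=
          integral_mono (hui _ (hP i) i) (hui _ (hP i) j) (huanti hj)
        have h3 := hPε i
        change ε - e j ≤ ∫ x, Y j x ∂P i
        linarith)
      (hcl 0) (fun i => (hcl i).isClosed)
    rw [Set.mem_iInter] at hy
    obtain ⟨Q, hQ, rfl⟩ := (hy 0).1
    have hQe : ∀ j, ε - 2 * e j ≤ ∫ x, u j x ∂Q := fun j => by
      have h1 := (hy j).2
      simp only [Set.mem_iInter] at h1
      have h2 : ε - e j ≤ ∫ x, Y j x ∂Q := h1 j le_rfl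
      have h3 := (abs_le.1 (hYint Q hQ j)).2
      linarith
    have := h𝒬.prob Q hQ
    have hlim : Tendsto (fun j => ∫ x, u j x ∂Q) atTop (𝓝 0) := by
      have := tendsto_integral_of_dominated_convergence (μ := Q) (F := u) (f := fun _ => 0)
        (fun _ => 2 * ‖f‖) (fun j => (hu j).continuous.measurable.aestronglyMeasurable)
        (integrable_const _) (fun j => Eventually.of_forall fun x => huM j x)
        (Eventually.of_forall hulim)
      simpa using this
    have hlim2 : Tendsto (fun j => ε - 2 * e j) atTop (𝓝 ε) := by
      simpa [e] using (tendsto_const_nhds (x := ε)).sub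
        ((tendsto_mul_geometric.const_mul 2).const_mul 2)
    have := le_of_tendsto_of_tendsto' hlim2 hlim hQe
    linarith
  obtain ⟨j, hj⟩ := key
  refine ⟨j, l j, lipLower_sub_le hfM j, hl j, fun Q hQ => ?_⟩
  refine le_trans ?_ (ENNReal.ofReal_le_ofReal (hj Q hQ))
  rw [ofReal_integral_eq_lintegral_ofReal (hui Q hQ j) (Eventually.of_forall (hu0 j))]
  refine lintegral_mono fun x => ENNReal.ofReal_le_ofReal ?_
  have h1 := hlf j x
  have h2 := hrf j x
  rw [abs_of_nonneg (by linarith)]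
  simp only [u]
  linarith

/-- A function in the completion of the bounded continuous functions is the quasi-sure limit of
bounded Lipschitz functions of finitely many coordinates. -/
theorem IIDFamily.exists_target {𝒬 : Set (Measure (ℕ → ℝ))} (h𝒬 : IIDFamily 𝒬)
    {φ : (ℕ → ℝ) → ℝ} (hφ : Measurable φ)
    (hLc : ∀ ε : ℝ≥0∞, 0 < ε → ∃ f : (ℕ → ℝ) →ᵇ ℝ, ∀ Q ∈ 𝒬,
      ∫⁻ x, ENNReal.ofReal |φ x - f x| ∂Q ≤ ε) :
    ∃ τ : ∀ n, (Fin n → ℝ) → ℝ, (∀ n, BddLip (τ n)) ∧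
      ∀ Q ∈ 𝒬, ∀ᵐ x ∂Q, Tendsto (fun n => τ n (restr n x)) atTop (𝓝 (φ x)) := by
  have key : ∀ k : ℕ, ∃ (K : ℕ) (g : (ℕ → ℝ) → ℝ), (∀ x y, |g x - g y| ≤ K * dist x y) ∧
      BddLip g ∧ ∀ Q ∈ 𝒬, ∫⁻ x, ENNReal.ofReal |φ x - g x| ∂Q ≤ 2⁻¹ ^ k + 2⁻¹ ^ k := by
    intro k
    obtain ⟨f, hf⟩ := hLc (2⁻¹ ^ k) (ENNReal.pow_pos (by simp) k)
    obtain ⟨K, g, h1, h2, h3⟩ := h𝒬.exists_lipschitz_approx f (ε := 2⁻¹ ^ k) (by positivity)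
    refine ⟨K, g, h1, h2, fun Q hQ => ?_⟩
    have hgm := h2.continuous.measurable
    calc ∫⁻ x, ENNReal.ofReal |φ x - g x| ∂Q
        ≤ ∫⁻ x, (ENNReal.ofReal |φ x - f x| + ENNReal.ofReal |f x - g x|) ∂Q := by
          refine lintegral_mono fun x => ?_
          rw [← ENNReal.ofReal_add (abs_nonneg _) (abs_nonneg _)]
          exact ENNReal.ofReal_le_ofReal (abs_sub_le _ _ _)
      _ = ∫⁻ x, ENNReal.ofReal |φ x - f x| ∂Q + ∫⁻ x, ENNReal.ofReal |f x - g x| ∂Q :=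
          lintegral_add_left ((hφ.sub f.continuous.measurable).abs.ennreal_ofReal) _
      _ ≤ _ := by
          refine add_le_add (hf Q hQ) ((h3 Q hQ).trans ?_)
          rw [ENNReal.ofReal_pow (by norm_num), ENNReal.ofReal_inv_of_pos (by norm_num)]
          simp
  choose K g hK hg hgQ using key
  -- The approximations are used slowly enough that their Lipschitz constant is eventually at most
  -- `n`; padding then costs at most `2 * n * 2⁻¹ ^ n`.
  let κ : ℕ → ℕ := fun n => Nat.findGreatest (fun k => K k ≤ n) n
  have hκ : Tendsto κ atTop atTop := by
    refine tendsto_atTop.2 fun k => ?_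
    filter_upwards [eventually_ge_atTop k, eventually_ge_atTop (K k)] with n h1 h2
    exact Nat.le_findGreatest h1 h2
  have hκK : ∀ᶠ n in atTop, K (κ n) ≤ n := by
    filter_upwards [eventually_ge_atTop (K 0)] with n hn
    exact Nat.findGreatest_spec (P := fun k => K k ≤ n) (Nat.zero_le n) hn
  refine ⟨fun n y => g (κ n) (pad n y), fun n => bddLip_comp_pad (hg _) n, fun Q hQ => ?_⟩
  have hae := ae_tendsto_of_tsum_lintegral (μ := Q) (fun k => (hg k).continuous.measurable) hφ
    (ne_top_of_le_ne_top (by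
      rw [ENNReal.tsum_add, ENNReal.tsum_geometric]
      simp) (ENNReal.tsum_le_tsum fun k => hgQ k Q hQ))
  filter_upwards [hae] with x hx
  have h1 := hx.comp hκ
  have h2 : Tendsto (fun n => g (κ n) (pad n (restr n x)) - g (κ n) x) atTop (𝓝 0) := by
    refine squeeze_zero_norm' ?_ tendsto_mul_geometric
    filter_upwards [hκK] with n hn
    rw [Real.norm_eq_abs, abs_sub_comm]
    refine (hK _ _ _).trans ?_
    calc (K (κ n) : ℝ) * dist x (pad n (restr n x)) ≤ n * (2 * (2 : ℝ)⁻¹ ^ n) := by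
          have : (K (κ n) : ℝ) ≤ n := by exact_mod_cast hn
          gcongr
          exact dist_pad_restr_le n x
      _ = _ := by ring
  simpa using h2.add h1

end SeqMetric

theorem BddLip.locLip {n : ℕ} {h : (Fin n → ℝ) → ℝ} (hh : BddLip h) : LocLip h := by
  obtain ⟨K, M, hK, -, h1, -⟩ := hh.exists_bounds
  refine ⟨K + 1, 0, by linarith, fun x y => (h1 x y).trans ?_⟩
  rw [dist_eq_norm]
  simp only [pow_zero]
  nlinarith [norm_nonneg (x - y)]

namespace SubLinSpace

variable {Ω : Type*} [MeasurableSpace Ω] {S : SubLinSpace Ω}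

/-! ### Bounded random variables -/

theorem measurable_sigma {Y : Ω → ℝ} (hY : Y ∈ S.H) : Measurable[S.sigma] Y := by
  have h : MeasurableSpace.comap Y (borel ℝ) ≤ S.sigma :=
    le_iSup₂ (f := fun (X : Ω → ℝ) (_ : X ∈ S.H) => MeasurableSpace.comap X (borel ℝ)) Y hY
  rw [← BorelSpace.measurable_eq (α := ℝ)] at h
  exact measurable_iff_comap_le.2 h

theorem measurable_seq_sigma {X : ℕ → Ω → ℝ} (hX : ∀ n, X n ∈ S.H) :
    Measurable[S.sigma] fun ω n => X n ω :=
  @measurable_pi_lambda _ _ _ S.sigma _ _ fun n => measurable_sigma (hX n)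

theorem const_mem_Hb (c : ℝ) : (fun _ : Ω => c) ∈ S.Hb :=
  ⟨S.comp_mem 0 Fin.elim0 (fun i => i.elim0) (fun _ => c) (BddLip.const c).locLip, |c|,
    fun _ => le_rfl⟩

theorem comp_mem_Hb {n : ℕ} {X : Fin n → Ω → ℝ} (hX : ∀ i, X i ∈ S.H) {h : (Fin n → ℝ) → ℝ}
    (hh : BddLip h) : (fun ω => h fun i => X i ω) ∈ S.Hb := by
  obtain ⟨M, hM⟩ := hh.2
  exact ⟨S.comp_mem n X hX h hh.locLip, M, fun ω => hM _⟩

theorem cyl_comp_mem_Hb {X : ℕ → Ω → ℝ} (hX : ∀ n, X n ∈ S.H) {n : ℕ} {Z : (ℕ → ℝ) → ℝ}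
    (hZ : Cyl n Z) : (fun ω => Z fun i => X i ω) ∈ S.Hb := by
  obtain ⟨h, hh, hZ⟩ := hZ
  simp only [hZ]
  exact comp_mem_Hb (X := fun i : Fin n => X i) (fun i => hX i) hh

theorem exists_coe_eq_E {Y : Ω → ℝ} (hY : Y ∈ S.Hb) : ∃ r : ℝ, S.E Y = r := by
  obtain ⟨hY, M, hM⟩ := hY
  have h1 : S.E Y ≤ (M : EReal) := by
    rw [← S.const M]
    exact S.mono _ (const_mem_Hb M).1 _ hY fun ω => (abs_le.1 (hM ω)).2
  have h2 : ((-M : ℝ) : EReal) ≤ S.E Y := by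
    rw [← S.const (-M)]
    exact S.mono _ hY _ (const_mem_Hb (-M)).1 fun ω => (abs_le.1 (hM ω)).1
  exact ⟨(S.E Y).toReal, (EReal.coe_toReal (ne_top_of_le_ne_top (EReal.coe_ne_top _) h1)
    (ne_bot_of_le_ne_bot (EReal.coe_ne_bot _) h2)).symm⟩

/-- A probability measure dominated by the sub-linear expectation satisfies Markov's inequality
with respect to it. -/
theorem measure_le_toENNReal_E {P : S.Prob}
    (hP : ∀ Y ∈ S.Hb, ((∫ ω, Y ω ∂P.1 : ℝ) : EReal) ≤ S.E Y) {Y : Ω → ℝ} (hY : Y ∈ S.Hb)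
    (hY0 : ∀ ω, 0 ≤ Y ω) {B : Set Ω} (hB : ∀ ω ∈ B, 1 ≤ Y ω) : P.1 B ≤ (S.E Y).toENNReal := by
  have hprob := P.2
  obtain ⟨M, hM⟩ := hY.2
  have hm : Measurable[S.sigma] Y := measurable_sigma hY.1
  have hint : Integrable Y P.1 :=
    Integrable.of_bound hm.aestronglyMeasurable M (Eventually.of_forall hM)
  have h1 : P.1 B ≤ ENNReal.ofReal (∫ ω, Y ω ∂P.1) := by
    rw [ofReal_integral_eq_lintegral_ofReal hint (Eventually.of_forall hY0)]
    have h2 := mul_meas_ge_le_lintegral (μ := P.1) hm.ennreal_ofReal 1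
    rw [one_mul] at h2
    refine (measure_mono fun ω hω => ?_).trans h2
    simpa using hB ω hω
  refine h1.trans ?_
  exact EReal.toENNReal_le_toENNReal (hP Y hY)

/-! ### Capacities -/

theorem upCap_mono {A B : Set Ω} (h : A ⊆ B) : S.upCap A ≤ S.upCap B := by
  refine le_iInf₂ fun ξ hξ => le_iInf fun hBξ => iInf₂_le_of_le ξ hξ (iInf_le_of_le ?_ le_rfl)
  exact fun ω => (Set.indicator_le_indicator_of_subset h (fun _ => zero_le_one) ω).trans (hBξ ω)

theorem upCap_le_one (A : Set Ω) : S.upCap A ≤ 1 := by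
  refine iInf₂_le_of_le (fun _ => 1) (const_mem_Hb 1).1 (iInf_le_of_le
    (Set.indicator_le_self' fun _ _ => zero_le_one) ?_)
  rw [S.const, EReal.real_coe_toENNReal, ENNReal.ofReal_one]

theorem one_le_upCap_univ : 1 ≤ S.upCap Set.univ := by
  refine le_iInf₂ fun ξ hξ => le_iInf fun h => ?_
  have h1 : S.E (fun _ => 1) ≤ S.E ξ := S.mono ξ hξ _ (const_mem_Hb 1).1 fun ω => by
    simpa using h ω
  have h2 := EReal.toENNReal_le_toENNReal h1
  rwa [S.const, EReal.real_coe_toENNReal, ENNReal.ofReal_one] at h2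

/-- A competitor `ξ` may be unbounded, where domination says nothing; clipped at 1 it still
dominates the indicator. -/
theorem measure_le_upCap {P : S.Prob}
    (hP : ∀ Y ∈ S.Hb, ((∫ ω, Y ω ∂P.1 : ℝ) : EReal) ≤ S.E Y) (B : Set Ω) :
    P.1 B ≤ S.upCap B := by
  refine le_iInf₂ fun ξ hξ => le_iInf fun h => ?_
  have h0 : ∀ ω, 0 ≤ ξ ω := fun ω => (Set.indicator_nonneg (fun _ _ => zero_le_one) ω).trans (h ω)
  have hclip : (fun ω => clip 1 (ξ ω)) ∈ S.Hb :=
    comp_mem_Hb (n := 1) (X := fun _ => ξ) (h := fun y => clip 1 (y 0)) (fun _ => hξ)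
      (.clip 1 (LipschitzWith.eval 0))
  refine (measure_le_toENNReal_E hP hclip (fun ω => ?_) fun ω hω => ?_).trans
    (EReal.toENNReal_le_toENNReal (S.mono ξ hξ _ hclip.1 fun ω => ?_))
  · exact le_max_of_le_right (le_min (h0 ω) zero_le_one)
  · have := h ω
    rw [Set.indicator_of_mem hω] at this
    exact le_max_of_le_right (le_min this le_rfl)
  · exact max_le (by linarith [h0 ω]) (min_le_left _ _)

theorem outCap_le_one (A : Set Ω) : S.outCap A ≤ 1 := by
  refine iInf₂_le_of_le (fun n => if n = 0 then Set.univ else ∅) (fun n => ?_)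
    (iInf_le_of_le ?_ ?_)
  · by_cases h : n = 0 <;> simp [h]
  · exact fun ω _ => Set.mem_iUnion.2 ⟨0, by simp⟩
  · have h0 : S.upCap ∅ = 0 := by
      refine le_antisymm (iInf₂_le_of_le (fun _ => 0) (const_mem_Hb 0).1
        (iInf_le_of_le (by simp) ?_)) bot_le
      rw [S.const]
      simp
    rw [tsum_eq_single 0 fun n hn => by simp [hn, h0]]
    exact upCap_le_one _

/-- An event of full measure under a dominated probability measure has outer capacity one. -/
theorem outCap_eq_one {P : S.Prob}
    (hP : ∀ Y ∈ S.Hb, ((∫ ω, Y ω ∂P.1 : ℝ) : EReal) ≤ S.E Y) {A : Set Ω} (hA : P.1 A = 1) :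
    S.outCap A = 1 := by
  refine le_antisymm (outCap_le_one A) (le_iInf₂ fun B _ => le_iInf fun hAB => ?_)
  rw [← hA]
  exact (measure_mono hAB).trans ((measure_iUnion_le B).trans
    (ENNReal.tsum_le_tsum fun n => measure_le_upCap hP (B n)))

theorem lintegral_upCap_ne_top {Y : Ω → ℝ} (hY : ∀ ω, 0 ≤ Y ω) (h : choquet S.upCap Y < ⊤) :
    ∫⁻ t in Set.Ioi (0 : ℝ), S.upCap {ω | t ≤ Y ω} ≠ ∞ := by
  have h0 : ∫⁻ t in Set.Iio (0 : ℝ), (1 - S.upCap {ω | t ≤ Y ω}) = 0 := by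
    rw [setLIntegral_congr_fun (g := fun _ => 0) measurableSet_Iio, lintegral_zero]
    intro t ht
    have : {ω | t ≤ Y ω} = Set.univ := Set.eq_univ_of_forall fun ω => (le_of_lt ht).trans (hY ω)
    simp only [this]
    exact tsub_eq_zero_of_le one_le_upCap_univ
  rw [choquet, h0] at h
  intro htop
  rw [htop] at h
  simp at h

/-- Comparison of the integral with its values at the right ends of intervals of length 1/2.
Half-integer levels are used because passing from `X n` to `X 0` halves the threshold. -/
theorem tsum_upCap_ne_top {Y : Ω → ℝ}
    (h : ∫⁻ t in Set.Ioi (0 : ℝ), S.upCap {ω | t ≤ Y ω} ≠ ∞) :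
    ∑' k : ℕ, S.upCap {ω | ((k : ℝ) + 1) / 2 ≤ Y ω} ≠ ∞ := by
  let I : ℕ → Set ℝ := fun k => Set.Ioc ((k : ℝ) / 2) (((k : ℝ) + 1) / 2)
  have hdisj : Pairwise (Function.onFun Disjoint I) := by
    intro i j hij
    refine Set.disjoint_left.2 fun t hi hj => hij ?_
    have h1 : (i : ℝ) < j + 1 := by linarith [hi.1, hj.2]
    have h2 : (j : ℝ) < i + 1 := by linarith [hj.1, hi.2]
    norm_cast at h1 h2
    omega
  have h1 : ∀ k : ℕ, 2⁻¹ * S.upCap {ω | ((k : ℝ) + 1) / 2 ≤ Y ω} ≤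
      ∫⁻ t in I k, S.upCap {ω | t ≤ Y ω} := by
    intro k
    have h2 : ∫⁻ _ in I k, S.upCap {ω | ((k : ℝ) + 1) / 2 ≤ Y ω} ≤
        ∫⁻ t in I k, S.upCap {ω | t ≤ Y ω} :=
      setLIntegral_mono' measurableSet_Ioc fun t ht => upCap_mono fun ω hω => ht.2.trans hω
    rw [setLIntegral_const, Real.volume_Ioc] at h2
    refine le_trans (le_of_eq ?_) h2
    rw [mul_comm, show ((k : ℝ) + 1) / 2 - k / 2 = 2⁻¹ by ring,
      ENNReal.ofReal_inv_of_pos two_pos]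
    simp
  have h3 : 2⁻¹ * ∑' k : ℕ, S.upCap {ω | ((k : ℝ) + 1) / 2 ≤ Y ω} ≤
      ∫⁻ t in Set.Ioi (0 : ℝ), S.upCap {ω | t ≤ Y ω} := by
    rw [← ENNReal.tsum_mul_left]
    refine (ENNReal.tsum_le_tsum h1).trans ?_
    rw [← lintegral_iUnion (fun k => measurableSet_Ioc) hdisj]
    refine lintegral_mono_set (Set.iUnion_subset fun k t ht => ?_)
    exact lt_of_le_of_lt (by positivity) ht.1
  intro htop
  rw [htop, ENNReal.mul_top (by simp), top_le_iff] at h3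
  exact h h3

/-! ### The family of laws of the sequence -/

/-- The law of the sequence `X` under `P`. -/
def seqLaw (X : ℕ → Ω → ℝ) (P : S.Prob) : Measure (ℕ → ℝ) :=
  @Measure.map Ω (ℕ → ℝ) S.sigma _ (fun ω n => X n ω) P.1

theorem integral_seqLaw {X : ℕ → Ω → ℝ} (hX : ∀ n, X n ∈ S.H) (P : S.Prob) {Z : (ℕ → ℝ) → ℝ}
    (hZ : Measurable Z) : ∫ x, Z x ∂(seqLaw X P) = ∫ ω, Z (fun n => X n ω) ∂P.1 :=
  integral_map (measurable_seq_sigma hX).aemeasurable hZ.aestronglyMeasurable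

theorem isProbabilityMeasure_seqLaw {X : ℕ → Ω → ℝ} (hX : ∀ n, X n ∈ S.H) (P : S.Prob) :
    IsProbabilityMeasure (seqLaw X P) :=
  have := P.2
  Measure.isProbabilityMeasure_map (measurable_seq_sigma hX).aemeasurable

section Transfer

variable {X : ℕ → Ω → ℝ} {Pfam : Set S.Prob}

theorem CC.le_E (hCC : S.CC Pfam) {P : S.Prob} (hP : P ∈ Pfam) {Y : Ω → ℝ} (hY : Y ∈ S.Hb) :
    ((∫ ω, Y ω ∂P.1 : ℝ) : EReal) ≤ S.E Y := by
  rw [hCC.repr Y hY]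
  exact le_iSup₂ (f := fun (P : S.Prob) (_ : P ∈ Pfam) => ((∫ ω, Y ω ∂P.1 : ℝ) : EReal)) P hP

theorem CC.nonempty (hCC : S.CC Pfam) : Pfam.Nonempty := by
  by_contra h
  rw [Set.not_nonempty_iff_eq_empty] at h
  have h1 := hCC.repr _ (const_mem_Hb 0)
  rw [S.const, h] at h1
  simp at h1

theorem CC.E_cyl (hCC : S.CC Pfam) (hX : ∀ n, X n ∈ S.H) {n : ℕ} {Z : (ℕ → ℝ) → ℝ}
    (hZ : Cyl n Z) : S.E (fun ω => Z fun i => X i ω) = (upE (seqLaw X '' Pfam) Z : EReal) := by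
  have hmem := cyl_comp_mem_Hb hX hZ
  obtain ⟨r, hr⟩ := exists_coe_eq_E hmem
  have hle : ∀ P ∈ Pfam, ∫ x, Z x ∂(seqLaw X P) ≤ r := by
    intro P hP
    have := hCC.le_E hP hmem
    rw [hr, ← integral_seqLaw hX P hZ.measurable] at this
    exact_mod_cast this
  have hub : ∀ y ∈ (fun Q : Measure (ℕ → ℝ) => ∫ x, Z x ∂Q) '' (seqLaw X '' Pfam), y ≤ r := by
    rintro _ ⟨_, ⟨P, hP, rfl⟩, rfl⟩
    exact hle P hP
  refine le_antisymm ?_ ?_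
  · rw [hCC.repr _ hmem]
    refine iSup₂_le fun P hP => ?_
    rw [← integral_seqLaw hX P hZ.measurable]
    exact EReal.coe_le_coe_iff.2 (le_csSup ⟨r, hub⟩ ⟨_, ⟨P, hP, rfl⟩, rfl⟩)
  · rw [hr]
    exact EReal.coe_le_coe_iff.2 (csSup_le ((hCC.nonempty.image _).image _) hub)

/-- A continuous image of the weakly compact set of laws of the bounded variables `Y j (X)`.
Clipping coordinate `j` at a bound for `Y j` makes its mean weakly continuous without changing its
value. -/
theorem CC.isCompact_moments (hCC : S.CC Pfam) (hX : ∀ n, X n ∈ S.H) {Y : ℕ → (ℕ → ℝ) → ℝ}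
    (hY : ∀ j, ∃ n, Cyl n (Y j)) :
    IsCompact ((fun (Q : Measure (ℕ → ℝ)) (j : ℕ) => ∫ x, Y j x ∂Q) '' (seqLaw X '' Pfam)) := by
  have hYm : ∀ j, Measurable (Y j) := fun j => (hY j).choose_spec.measurable
  have hYb : ∀ j, ∃ M : ℝ, 0 ≤ M ∧ ∀ x, |Y j x| ≤ M := fun j => by
    obtain ⟨M, hM⟩ := (hY j).choose_spec.exists_bound
    exact ⟨max M 0, le_max_right _ _, fun x => (hM x).trans (le_max_left _ _)⟩
  choose M hM0 hM using hYb
  have hmem : ∀ j, (fun ω => Y j fun i => X i ω) ∈ S.Hb := fun j =>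
    cyl_comp_mem_Hb hX (hY j).choose_spec
  have hmeas : Measurable[S.sigma] fun (ω : Ω) (j : ℕ) => Y j fun i => X i ω :=
    measurable_seq_sigma fun j => (hmem j).1
  let b : ℕ → (ℕ → ℝ) →ᵇ ℝ := fun j => BoundedContinuousFunction.ofNormedAddCommGroup
    (fun y => clip (M j) (y j)) ((continuous_clip _).comp (continuous_apply j)) (M j)
    fun y => abs_clip_le (hM0 j) _
  have hcomp := (hCC.compact (fun j ω => Y j fun i => X i ω) hmem).image
    (f := fun (ν : ProbabilityMeasure (ℕ → ℝ)) (j : ℕ) => ∫ y, b j y ∂(ν : Measure (ℕ → ℝ)))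
    (continuous_pi fun j =>
      ProbabilityMeasure.continuous_integral_boundedContinuousFunction (b j))
  have key : ∀ (P : S.Prob) (ν : Measure (ℕ → ℝ)), (∀ A : Set (ℕ → ℝ), MeasurableSet A →
      ν A = P.1 {ω | (fun j => Y j fun i => X i ω) ∈ A}) →
      ∀ j, ∫ y, b j y ∂ν = ∫ x, Y j x ∂(seqLaw X P) := by
    intro P ν hν j
    have hνmap : ν = @Measure.map Ω (ℕ → ℝ) S.sigma _ (fun ω j => Y j fun i => X i ω) P.1 := by
      ext A hA
      rw [hν A hA, Measure.map_apply hmeas hA]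
      rfl
    rw [hνmap, integral_map hmeas.aemeasurable (b j).continuous.aestronglyMeasurable,
      integral_seqLaw hX P (hYm j)]
    refine integral_congr_ae (Eventually.of_forall fun ω => ?_)
    exact clip_eq_self (hM j _)
  convert hcomp using 1
  ext y
  constructor
  · rintro ⟨_, ⟨P, hP, rfl⟩, rfl⟩
    have hprob := P.2
    let ν : ProbabilityMeasure (ℕ → ℝ) :=
      ⟨@Measure.map Ω (ℕ → ℝ) S.sigma _ (fun ω j => Y j fun i => X i ω) P.1,
        Measure.isProbabilityMeasure_map hmeas.aemeasurable⟩
    have hν : ∀ A : Set (ℕ → ℝ), MeasurableSet A →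
        ν.1 A = P.1 {ω | (fun j => Y j fun i => X i ω) ∈ A} := fun A hA =>
      Measure.map_apply hmeas hA
    exact ⟨ν, ⟨P, hP, hν⟩, funext fun j => key P ν.1 hν j⟩
  · rintro ⟨ν, ⟨P, hP, hν⟩, rfl⟩
    exact ⟨_, ⟨P, hP, rfl⟩, funext fun j => (key P ν.1 hν j).symm⟩

/-- Identical distribution replaces `X (i + 1)` by `X 0` in the inner expectation. The resulting
function of the past inherits the bound and Lipschitz constant of `φ`, so the outer expectation is
also one of a cylinder function. -/
theorem CC.indep_laws (hCC : S.CC Pfam) (hX : S.IsIID X) (i : ℕ)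
    {φ : (Fin (i + 1) → ℝ) × ℝ → ℝ} (hφ : BddLip φ) :
    upE (seqLaw X '' Pfam) (fun x => φ (restr (i + 1) x, x (i + 1))) =
      upE (seqLaw X '' Pfam)
        (fun x => upE (seqLaw X '' Pfam) fun y => φ (restr (i + 1) x, y 0)) := by
  obtain ⟨K, M, hK0, hM0, hK, hM⟩ := hφ.exists_bounds
  have hφa : ∀ a, BddLip fun t : Fin 1 → ℝ => φ (a, t 0) := fun a =>
    hφ.comp (K := 1) (u := fun t : Fin 1 → ℝ => (a, t 0))
      (by simpa using (LipschitzWith.const a).prodMk (LipschitzWith.eval (0 : Fin 1)))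
  have hcyl0 : ∀ a, Cyl 1 fun y => φ (a, y 0) := fun a => ⟨_, hφa a, fun _ => rfl⟩
  have hinner : ∀ a, S.E (fun ω => φ (a, X (i + 1) ω)) =
      (upE (seqLaw X '' Pfam) fun y => φ (a, y 0) : ℝ) := fun a => by
    rw [← hCC.E_cyl hX.mem (hcyl0 a)]
    exact hX.ident (i + 1) _ (hφa a)
  have hcyl : Cyl (i + 2) fun x => φ (restr (i + 1) x, x (i + 1)) :=
    ⟨fun y => φ (fun j => y (Fin.castSucc j), y (Fin.last (i + 1))), hφ.comp (K := 1)
      (LipschitzWith.of_dist_le_mul fun y z => by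
        rw [NNReal.coe_one, one_mul, Prod.dist_eq]
        exact max_le ((dist_pi_le_iff dist_nonneg).2 fun j => dist_le_pi_dist y z _)
          (dist_le_pi_dist y z _)), fun x => rfl⟩
  have hbd : ∀ a, ∀ P ∈ Pfam, |∫ y, φ (a, y 0) ∂(seqLaw X P)| ≤ M := fun a P hP => by
    have := isProbabilityMeasure_seqLaw hX.mem P
    have := norm_integral_le_of_norm_le_const (μ := seqLaw X P) (f := fun y => φ (a, y 0))
      (Eventually.of_forall fun y => hM _)
    simpa using this
  have hle : ∀ a, ∀ P ∈ Pfam, ∫ y, φ (a, y 0) ∂(seqLaw X P) ≤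
      upE (seqLaw X '' Pfam) fun y => φ (a, y 0) := fun a P hP =>
    le_csSup ⟨M, by rintro _ ⟨_, ⟨P, hP, rfl⟩, rfl⟩; exact (abs_le.1 (hbd a P hP)).2⟩
      ⟨_, ⟨P, hP, rfl⟩, rfl⟩
  have hsub : ∀ a a', upE (seqLaw X '' Pfam) (fun y => φ (a, y 0)) -
      upE (seqLaw X '' Pfam) (fun y => φ (a', y 0)) ≤ K * dist a a' := fun a a' => by
    rw [sub_le_iff_le_add]
    refine csSup_le ((hCC.nonempty.image _).image _) ?_
    rintro _ ⟨_, ⟨P, hP, rfl⟩, rfl⟩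
    have := isProbabilityMeasure_seqLaw hX.mem P
    have h1 := hle a' P hP
    have h2 : ∫ y, φ (a, y 0) ∂(seqLaw X P) ≤
        ∫ y, (K * dist a a' + φ (a', y 0)) ∂(seqLaw X P) := by
      refine integral_mono ((hcyl0 a).integrable _)
        ((integrable_const _).add ((hcyl0 a').integrable _)) fun y => ?_
      have h3 := (abs_le.1 (hK (a, y 0) (a', y 0))).2
      rw [Prod.dist_eq, dist_self, max_eq_left dist_nonneg] at h3
      dsimp only
      linarith
    rw [integral_add (integrable_const _) ((hcyl0 a').integrable _)] at h2
    simp only [integral_const, probReal_univ, smul_eq_mul, one_mul] at h2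
    dsimp only
    linarith
  have houter : BddLip fun a : Fin (i + 1) → ℝ =>
      upE (seqLaw X '' Pfam) fun y => φ (a, y 0) := by
    refine BddLip.of_dist_le (K := K) (M := M) (fun a a' => abs_le.2 ⟨?_, hsub a a'⟩) fun a => ?_
    · have := hsub a' a
      rw [dist_comm] at this
      linarith
    · obtain ⟨P, hP⟩ := hCC.nonempty
      refine abs_le.2 ⟨(abs_le.1 (hbd a P hP)).1.trans (hle a P hP), ?_⟩
      refine csSup_le (Set.Nonempty.image _ ⟨_, ⟨P, hP, rfl⟩⟩) ?_
      rintro _ ⟨_, ⟨P, hP, rfl⟩, rfl⟩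
      exact (abs_le.1 (hbd a P hP)).2
  have h1 := hX.indep i (fun p => φ (p.1, p.2 0)) (hφ.comp (K := 1)
    (LipschitzWith.of_dist_le_mul fun p q => by
      rw [NNReal.coe_one, one_mul, Prod.dist_eq, Prod.dist_eq]
      exact max_le_max le_rfl (dist_le_pi_dist p.2 q.2 0)))
  simp only [hinner, EReal.toReal_coe] at h1
  have h2 := hCC.E_cyl hX.mem hcyl
  have h3 := hCC.E_cyl hX.mem (Cyl.comp_restr houter)
  exact EReal.coe_eq_coe_iff.1 (h2.symm.trans (h1.trans h3))

theorem CC.tail_laws (hCC : S.CC Pfam) (hX : S.IsIID X)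
    (hmoment : choquet S.upCap (fun ω => |X 0 ω|) < ⊤) :
    ∃ w : ℕ → ℝ, (∀ k, 0 ≤ w k) ∧ Summable w ∧ ∀ Q ∈ seqLaw X '' Pfam, ∀ n k : ℕ,
      Q {x | (k : ℝ) ≤ |x n|} ≤ ENNReal.ofReal (w k) := by
  have hsum := tsum_upCap_ne_top (lintegral_upCap_ne_top (fun ω => abs_nonneg (X 0 ω)) hmoment)
  let w : ℕ → ℝ := fun k => if k = 0 then 1 else (S.upCap {ω | (k : ℝ) / 2 ≤ |X 0 ω|}).toReal
  refine ⟨w, fun k => ?_, ?_, ?_⟩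
  · by_cases h : k = 0 <;> simp [w, h]
  · refine (summable_nat_add_iff 1).1 ((ENNReal.summable_toReal hsum).congr fun k => ?_)
    simp [w]
  rintro _ ⟨P, hP, rfl⟩ n k
  have hprob := isProbabilityMeasure_seqLaw hX.mem P
  rcases Nat.eq_zero_or_pos k with rfl | hk
  · simp [w]
  have hk' : (0 : ℝ) < k := by exact_mod_cast hk
  have hw : ENNReal.ofReal (w k) = S.upCap {ω | (k : ℝ) / 2 ≤ |X 0 ω|} := by
    simp only [w, hk.ne', if_false]
    exact ENNReal.ofReal_toReal (ne_top_of_le_ne_top ENNReal.one_ne_top (upCap_le_one _))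
  rw [hw]
  -- Identical distribution is known only for bounded Lipschitz functions, so the indicator is
  -- replaced by a ramp that rises from 0 at `k / 2` to 1 at `k`.
  let ℓ : (Fin 1 → ℝ) → ℝ := fun y => max 0 (min (2 / k * |y 0| - 1) 1)
  have hℓ : BddLip ℓ := by
    have h1 : LipschitzWith (Real.toNNReal (2 / k)) fun y : Fin 1 → ℝ => 2 / k * |y 0| - 1 := by
      refine LipschitzWith.of_dist_le_mul fun y z => ?_
      rw [Real.coe_toNNReal _ (by positivity), Real.dist_eq]
      have h2 := (abs_abs_sub_abs_le_abs_sub (y 0) (z 0)).trans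
        (by simpa [Real.dist_eq] using dist_le_pi_dist y z 0)
      rw [show 2 / (k : ℝ) * |y 0| - 1 - (2 / k * |z 0| - 1) = 2 / k * (|y 0| - |z 0|) by ring,
        abs_mul, abs_of_pos (by positivity : (0 : ℝ) < 2 / k)]
      gcongr
    exact BddLip.clamp 0 1 h1
  have hmem : ∀ j, (fun ω => ℓ fun _ => X j ω) ∈ S.Hb := fun j =>
    comp_mem_Hb (X := fun _ => X j) (fun _ => hX.mem j) hℓ
  refine le_iInf₂ fun ξ hξ => le_iInf fun h => ?_
  have h1 : seqLaw X P {x | (k : ℝ) ≤ |x n|} = P.1 {ω | (k : ℝ) ≤ |X n ω|} :=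
    Measure.map_apply (measurable_seq_sigma hX.mem)
      (measurableSet_le measurable_const (measurable_pi_apply n).abs)
  rw [h1]
  refine (measure_le_toENNReal_E (fun Y hY => hCC.le_E hP hY) (hmem n) (fun ω => le_max_left _ _)
    fun ω hω => ?_).trans (EReal.toENNReal_le_toENNReal ?_)
  · refine le_max_of_le_right (le_min ?_ le_rfl)
    have : 2 / (k : ℝ) * k ≤ 2 / k * |X n ω| := mul_le_mul_of_nonneg_left hω (by positivity)
    rw [div_mul_cancel₀ _ hk'.ne'] at this
    linarith
  · rw [hX.ident n ℓ hℓ]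
    refine S.mono ξ hξ _ (hmem 0).1 fun ω => le_trans ?_ (h ω)
    by_cases hω : (k : ℝ) / 2 ≤ |X 0 ω|
    · rw [Set.indicator_of_mem (show ω ∈ {ω | (k : ℝ) / 2 ≤ |X 0 ω|} from hω)]
      exact max_le zero_le_one (min_le_right _ _)
    · rw [Set.indicator_of_notMem (show ω ∉ {ω | (k : ℝ) / 2 ≤ |X 0 ω|} from hω)]
      refine max_le le_rfl ((min_le_left _ _).trans ?_)
      push Not at hω
      have : 2 / (k : ℝ) * |X 0 ω| ≤ 2 / k * (k / 2) :=
        mul_le_mul_of_nonneg_left hω.le (by positivity)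
      rw [div_mul_div_cancel₀ hk'.ne'] at this
      linarith

theorem CC.iidFamily (hCC : S.CC Pfam) (hX : S.IsIID X)
    (hmoment : choquet S.upCap (fun ω => |X 0 ω|) < ⊤) : IIDFamily (seqLaw X '' Pfam) where
  nonempty := hCC.nonempty.image _
  prob := by
    rintro _ ⟨P, -, rfl⟩
    exact isProbabilityMeasure_seqLaw hX.mem P
  compact _ hY := hCC.isCompact_moments hX.mem hY
  indep i _ hφ := hCC.indep_laws hX i hφ
  tail := hCC.tail_laws hX hmoment

theorem seqLaw_ae_limEvent (hX : ∀ n, X n ∈ S.H) {P : S.Prob} {lo hi : ℝ} {φ : (ℕ → ℝ) → ℝ}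
    (h : ∀ᵐ x ∂(seqLaw X P), Tendsto (fun n : ℕ => (∑ i ∈ Finset.range n, x i) / (n : ℝ)) atTop
      (𝓝 (max lo (min (φ x) hi)))) :
    P.1 (limEvent X lo hi fun ω => φ fun i => X i ω) = 1 := by
  have hprob := P.2
  have h1 := ae_of_ae_map (measurable_seq_sigma hX).aemeasurable h
  rw [← measure_univ (μ := P.1)]
  exact measure_congr (eventuallyEq_univ.2 h1)

end Transfer

end SubLinSpace

end SubLin

end

/-! ### The theorem -/

open SubLin SubLin.SubLinSpace

theorem corollary2p1 {Ω : Type*} [MeasurableSpace Ω] (S : SubLin.SubLinSpace Ω)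
    (X : ℕ → Ω → ℝ) (hX : S.IsIID X)
    (hmoment : SubLin.choquet S.upCap (fun ω => |X 0 ω|) < ⊤)
    (Pfam : Set S.Prob) (hCC : S.CC Pfam) :
    ∃ μlo μhi : ℝ,
      -- the upper and lower means, as limits of truncated expectations
      S.IsTruncMean (X 0) μhi ∧ S.IsTruncMean (fun ω => -X 0 ω) (-μlo) ∧
      -- (a) finite-dimensional Borel functions
      (∀ (d : ℕ) (φ : (Fin d → ℝ) → ℝ), Measurable φ →
        ∃ Q : S.Prob,
          (∀ Y ∈ S.Hb, ((∫ ω, Y ω ∂Q.1 : ℝ) : EReal) ≤ S.E Y) ∧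
          S.outCap (SubLin.limEvent X μlo μhi (fun ω => φ (fun i => X i ω))) = 1 ∧
          Q.1 (SubLin.limEvent X μlo μhi (fun ω => φ (fun i => X i ω))) = 1) ∧
      -- (b) continuous functions of the whole sequence
      (∀ φ : (ℕ → ℝ) → ℝ, Continuous φ →
        ∃ P ∈ Pfam,
          S.outCap (SubLin.limEvent X μlo μhi (fun ω => φ (fun i => X i ω))) = 1 ∧
          P.1 (SubLin.limEvent X μlo μhi (fun ω => φ (fun i => X i ω))) = 1) ∧
      -- the extension of (b) to the space `𝕃_c`
      (∀ φ : (ℕ → ℝ) → ℝ, S.MemLc Pfam X φ →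
        ∃ P ∈ Pfam,
          S.outCap (SubLin.limEvent X μlo μhi (fun ω => φ (fun i => X i ω))) = 1 ∧
          P.1 (SubLin.limEvent X μlo μhi (fun ω => φ (fun i => X i ω))) = 1) := by
  have h𝒬 := hCC.iidFamily hX hmoment
  obtain ⟨H, hH⟩ := h𝒬.exists_tendsto_upE 1 (by simp)
  obtain ⟨L', hL'⟩ := h𝒬.exists_tendsto_upE (-1) (by simp)
  obtain ⟨L, rfl⟩ : ∃ L, L' = -L := ⟨-L', (neg_neg L').symm⟩
  simp only [one_mul] at hH
  simp only [neg_mul, one_mul] at hL'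
  have hhi : Tendsto (fun n : ℕ => upperMean (seqLaw X '' Pfam) n) atTop (𝓝 H) :=
    hH.comp tendsto_natCast_atTop_atTop
  have hlo : Tendsto (fun n : ℕ => lowerMean (seqLaw X '' Pfam) n) atTop (𝓝 L) := by
    simpa [lowerMean] using (hL'.comp tendsto_natCast_atTop_atTop).neg
  have hLH : L ≤ H := le_of_tendsto_of_tendsto' hlo hhi fun n => h𝒬.lowerMean_le_upperMean n
  have hclip : ∀ c, Cyl 1 fun x => clip c (x 0) := fun c => Cyl.clip_apply c zero_lt_one
  have hLc : ∀ φ : (ℕ → ℝ) → ℝ, S.MemLc Pfam X φ → ∃ P ∈ Pfam,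
      S.outCap (limEvent X L H (fun ω => φ (fun i => X i ω))) = 1 ∧
      P.1 (limEvent X L H (fun ω => φ (fun i => X i ω))) = 1 := by
    rintro φ ⟨hφ, happ⟩
    obtain ⟨τ, hτ, hτφ⟩ := h𝒬.exists_target hφ fun ε hε => by
      obtain ⟨f, hf⟩ := happ ε hε
      refine ⟨f, ?_⟩
      rintro _ ⟨P, hP, rfl⟩
      refine le_trans (le_of_eq ?_) ((le_iSup₂ (f := fun (P : S.Prob) (_ : P ∈ Pfam) =>
        ∫⁻ ω, ENNReal.ofReal |φ (fun n => X n ω) - f (fun n => X n ω)| ∂P.1) P hP).trans hf)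
      exact @lintegral_map _ _ S.sigma _ P.1 _ _
        ((hφ.sub f.continuous.measurable).abs.ennreal_ofReal)
        (measurable_seq_sigma hX.mem)
    obtain ⟨_, ⟨P, hP, rfl⟩, hlim⟩ := h𝒬.exists_tendsto_of_approx hLH hlo hhi hτ hτφ
    have h1 := seqLaw_ae_limEvent hX.mem hlim
    exact ⟨P, hP, outCap_eq_one (fun Y hY => hCC.le_E hP hY) h1, h1⟩
  refine ⟨L, H, ?_, ?_, fun d φ hφ => ?_, fun φ hφ => ?_, hLc⟩
  · refine ((continuous_coe_real_ereal.tendsto H).comp hH).congr fun c => ?_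
    exact (hCC.E_cyl hX.mem (hclip c)).symm
  · refine ((continuous_coe_real_ereal.tendsto (-L)).comp hL').congr' ?_
    filter_upwards [eventually_ge_atTop 0] with c hc
    have h1 : Cyl 1 fun x => -clip c (x 0) := by simpa using (hclip c).const_mul (-1)
    refine (hCC.E_cyl hX.mem h1).symm.trans ?_
    simp only [← clip_neg hc]
    rfl
  -- Control needs at least one past coordinate, so `φ` is regarded as a function of `d + 1`
  -- coordinates, which covers `d = 0`.
  · obtain ⟨_, ⟨P, hP, rfl⟩, hlim⟩ := h𝒬.exists_tendsto_of_measurable hLH hlo hhi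
      (Nat.le_add_left 1 d) (φ := fun y => φ fun i => y (Fin.castSucc i))
      (hφ.comp (measurable_pi_lambda _ fun i => measurable_pi_apply _))
    have h1 := seqLaw_ae_limEvent (φ := fun x => φ fun i : Fin d => x i) hX.mem hlim
    exact ⟨P, fun Y hY => hCC.le_E hP hY, outCap_eq_one (fun Y hY => hCC.le_E hP hY) h1, h1⟩
  -- Clamping is idempotent, so `φ` may be replaced by its clamped version, which is bounded and
  -- continuous.
  · have hcl : ∀ z : ℝ, max L (min (max L (min z H)) H) = max L (min z H) := fun z => by
      rw [min_eq_left (max_le hLH (min_le_right z H)), max_eq_right (le_max_left _ _)]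
    have hcont : Continuous fun x => max L (min (φ x) H) :=
      continuous_const.max (hφ.min continuous_const)
    let f : (ℕ → ℝ) →ᵇ ℝ := BoundedContinuousFunction.ofNormedAddCommGroup
      (fun x => max L (min (φ x) H)) hcont (max |L| |H|) fun x =>
        abs_le_max_abs_abs (le_max_left _ _) (max_le hLH (min_le_right _ _))
    have := hLc (fun x => max L (min (φ x) H)) ⟨hcont.measurable, fun ε hε => ⟨f, by simp [f]⟩⟩
    simpa only [limEvent, hcl] using this
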